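/- Let $M$ be a finite-dimensional smooth manifold and $\pi:M\to\mathbb R$ a smooth surjective submersion. Let $V\pi=\ker T\pi\subset TM$ be its vertical bundle, $V^*\pi$ the dual vector bundle of $V\pi$, and $\mu_\pi:T^*M\to V^*\pi$ the dual of the inclusion $V\pi\hookrightarrow TM$. Let $\Omega_M=-d\theta_M$ be the canonical symplectic form of $T^*M$ ($\theta_M$ the Liouville $1$-form), and let $\psi:\mathbb R\times T^*M\to T^*M$ be given by $\psi_s(\alpha_x)=\alpha_x+s\,(\pi^*dt)(x)$ for $\alpha_x\in T^*_xM$. Let $\phi:G\times M\to M$ be a smooth action of a connected Lie group $G$ with Lie algebra $\mathfrak g$, and let $T^*\phi:G\times T^*M\to T^*M$, $T^*\phi_g(\alpha_x)=\alpha_x\circ(T_x\phi_g)^{-1}\in T^*_{\phi_g(x)}M$, be its cotangent lift. Suppose that $\pi$ is $G$-invariant, i.e. $\pi\circ\phi_g=\pi$ for all $g\in G$. Then $\mu_\pi:(T^*M,\Omega_M)\to V^*\pi$ is a symplectic principal $\mathbb R$-bundle with principal action $\psi$ (that is, $\mu_\pi$ is a smooth principal $\mathbb R$-bundle with principal action $\psi$,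 $\Omega_M$ is a symplectic form, and $\psi_s^*\Omega_M=\Omega_M$ for all $s\in\mathbb R$), and $T^*\phi$ is a canonical action on it, that is, $T^*\phi$ is a smooth action of $G$ on $T^*M$ such that (i) $T^*\phi$ is symplectic: $(T^*\phi_g)^*\Omega_M=\Omega_M$ for all $g\in G$; (ii) $T^*\phi_g\circ\psi_s=\psi_s\circ T^*\phi_g$ for all $g\in G$, $s\in\mathbb R$; (iii) $\zeta_{\mu_\pi}=i_{Z_{\mu_\pi}}\Omega_M$ is basic with respect to $T^*\phi$: $\zeta_{\mu_\pi}(\xi_{T^*M})=0$ for all $\xi\in\mathfrak g$, where $Z_{\mu_\pi}$ is the infinitesimal generator of $\psi$ and $\xi_{T^*M}$ is the infinitesimal generator of $T^*\phi$ defined by $\xi$. -/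

import Mathlib

open Bundle Set Module Topology
open scoped Manifold ContDiff

noncomputable section

/-! ### Differential forms on manifolds -/

section Forms

variable {F : Type*} [NormedAddCommGroup F] [NormedSpace ℝ F] {K : Type*} [TopologicalSpace K]
  (J : ModelWithCorners ℝ F K) {N : Type*} [TopologicalSpace N] [ChartedSpace K N] {k : ℕ}

/-- (Not necessarily smooth) differential `k`-forms on the manifold `N`. -/
abbrev DiffForm (N : Type*) [TopologicalSpace N] [ChartedSpace K N] (k : ℕ) : Type _ :=
  ∀ x : N, TangentSpace J x [⋀^Fin k]→L[ℝ] ℝ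

variable {J}

/-- The local representative of `η` in the chart at `x₀`: the pullback of `η` by the inverse
of that chart, a form on (an open part of) the model vector space `F`. -/
def DiffForm.inChart (η : DiffForm J N k) (x₀ : N) (y : F) : F [⋀^Fin k]→L[ℝ] ℝ :=
  (η ((extChartAt J x₀).symm y)).compContinuousLinearMap
    (mfderivWithin 𝓘(ℝ, F) J (extChartAt J x₀).symm (range J) y :
      F →L[ℝ] TangentSpace J ((extChartAt J x₀).symm y))

/-- `η` is `C^∞`: all its local representatives are. -/
def DiffForm.IsSmooth (η : DiffForm J N k) : Prop :=
  ∀ x₀ : N, ContDiffOn ℝ ∞ (η.inChart x₀) (extChartAt J x₀).target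

/-- The exterior derivative `dη`: at `x`, differentiate the local representative of `η` in the
chart at `x` and pull the result back to the manifold. -/
def DiffForm.d (η : DiffForm J N k) : DiffForm J N (k + 1) := fun x =>
  (extDerivWithin (η.inChart x) (range J) (extChartAt J x x)).compContinuousLinearMap
    (mfderiv J 𝓘(ℝ, F) (extChartAt J x) x : TangentSpace J x →L[ℝ] F)

/-- The pullback `f^* η` by a self-map. -/
def DiffForm.pullback (f : N → N) (η : DiffForm J N k) : DiffForm J N k := fun x =>
  (η (f x)).compContinuousLinearMap (mfderiv J J f x)

/-- `Ω` is a symplectic form: a smooth, closed and nondegenerate `2`-form. -/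
structure IsSymplecticForm (Ω : DiffForm J N 2) : Prop where
  smooth : Ω.IsSmooth
  closed : ∀ x : N, Ω.d x = 0
  nondegenerate : ∀ (x : N) (u : TangentSpace J x),
    (∀ v : TangentSpace J x, Ω x ![u, v] = 0) → u = 0

end Forms

/-! ### Actions, symplectic principal `ℝ`-bundles and canonical actions -/

section Actions

variable {F : Type*} [NormedAddCommGroup F] [NormedSpace ℝ F] {K : Type*} [TopologicalSpace K]
  (J : ModelWithCorners ℝ F K) {A : Type*} [TopologicalSpace A] [ChartedSpace K A]

/-- `Φ` is a smooth (left) action of the Lie group `G` on the manifold `A`. -/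
structure IsLieGroupAction {EG : Type*} [NormedAddCommGroup EG] [NormedSpace ℝ EG] {HG : Type*}
    [TopologicalSpace HG] (IG : ModelWithCorners ℝ EG HG) {G : Type*} [Group G]
    [TopologicalSpace G] [ChartedSpace HG G] (Φ : G → A → A) : Prop where
  one_act : ∀ a, Φ 1 a = a
  mul_act : ∀ g h a, Φ (g * h) a = Φ g (Φ h a)
  contMDiff : ContMDiff (IG.prod J) J ∞ (fun q : G × A => Φ q.1 q.2)

/-- The infinitesimal generator `ξ_A` of the action `Φ` defined by `ξ ∈ 𝔤 = T₁G`: the value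
`ξ_A(a)` is the image of `ξ` under the differential at `1` of the orbit map `g ↦ Φ g a`. -/
def infinitesimalGenerator {EG : Type*} [NormedAddCommGroup EG] [NormedSpace ℝ EG] {HG : Type*}
    [TopologicalSpace HG] (IG : ModelWithCorners ℝ EG HG) {G : Type*} [Group G]
    [TopologicalSpace G] [ChartedSpace HG G] (Φ : G → A → A)
    (ξ : GroupLieAlgebra IG G) (a : A) : TangentSpace J a :=
  -- `Φ 1 a = a`, so this differential takes its values in `T_a A`
  (mfderiv IG J (fun g : G => Φ g a) 1 ξ : TangentSpace J (Φ 1 a))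

/-- The infinitesimal generator of an action `ψ` of `(ℝ, +)`: the velocity at `s = 0` of the
orbits `s ↦ ψ s a`. -/
def realGenerator (ψ : ℝ → A → A) (a : A) : TangentSpace J a :=
  -- `ψ 0 a = a`, so this velocity lies in `T_a A`
  (mfderiv 𝓘(ℝ, ℝ) J (fun s : ℝ => ψ s a) 0 (1 : ℝ) : TangentSpace J (ψ 0 a))

variable {FV : Type*} [NormedAddCommGroup FV] [NormedSpace ℝ FV] {KV : Type*}
  [TopologicalSpace KV] (JV : ModelWithCorners ℝ FV KV) {V : Type*} [TopologicalSpace V]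
  [ChartedSpace KV V]

/-- `μ : A → V` is a (smooth) principal `ℝ`-bundle with principal action `ψ` of `(ℝ, +)`: `ψ` is
a smooth action along the fibres of `μ`, and `μ` has smooth `ℝ`-equivariant local trivializations
`μ⁻¹(U) ≃ U × ℝ` around every point of `V`. -/
structure IsPrincipalRBundle (μ : A → V) (ψ : ℝ → A → A) : Prop where
  contMDiff_proj : ContMDiff J JV ∞ μ
  zero_act : ∀ a, ψ 0 a = a
  add_act : ∀ s t a, ψ (s + t) a = ψ s (ψ t a)
  contMDiff_act : ContMDiff (𝓘(ℝ, ℝ).prod J) J ∞ (fun q : ℝ × A => ψ q.1 q.2)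
  proj_act : ∀ s a, μ (ψ s a) = μ a
  locallyTrivial : ∀ v : V, ∃ e : Trivialization ℝ μ, v ∈ e.baseSet ∧
    ContMDiffOn J (JV.prod 𝓘(ℝ, ℝ)) ∞ e e.source ∧
    ContMDiffOn (JV.prod 𝓘(ℝ, ℝ)) J ∞ e.toOpenPartialHomeomorph.symm e.target ∧
    ∀ s, ∀ a ∈ e.source, e (ψ s a) = ((e a).1, (e a).2 + s)

/-- `μ : (A, Ω) → V` is a symplectic principal `ℝ`-bundle with principal action `ψ`. -/
structure IsSymplecticPrincipalRBundle (μ : A → V) (ψ : ℝ → A → A) (Ω : DiffForm J A 2) :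
    Prop where
  principal : IsPrincipalRBundle J JV μ ψ
  symplectic : IsSymplecticForm Ω
  act_symplectic : ∀ s : ℝ, Ω.pullback (ψ s) = Ω

/-- The action `Φ` of the Lie group `G` on `A` is canonical with respect to the symplectic form
`Ω` and the principal action `ψ` of a symplectic principal `ℝ`-bundle `(A, Ω) → V` with
infinitesimal generator `Z`: it is symplectic, it commutes with `ψ`, and the `1`-form
`ζ = i_Z Ω` vanishes on the infinitesimal generators of `Φ`. -/
structure IsCanonicalAction {EG : Type*} [NormedAddCommGroup EG] [NormedSpace ℝ EG] {HG : Type*}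
    [TopologicalSpace HG] (IG : ModelWithCorners ℝ EG HG) {G : Type*} [Group G]
    [TopologicalSpace G] [ChartedSpace HG G] (ψ : ℝ → A → A) (Ω : DiffForm J A 2)
    (Φ : G → A → A) : Prop where
  action : IsLieGroupAction J IG Φ
  symplectic : ∀ g : G, Ω.pullback (Φ g) = Ω
  commute : ∀ (g : G) (s : ℝ) (a : A), Φ g (ψ s a) = ψ s (Φ g a)
  basic : ∀ (ξ : GroupLieAlgebra IG G) (a : A),
    Ω a ![realGenerator J ψ a, infinitesimalGenerator J IG Φ ξ a] = 0

end Actions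

/-! ### The cotangent bundle -/

section Cotangent

variable {E : Type*} [NormedAddCommGroup E] [NormedSpace ℝ E] {H : Type*} [TopologicalSpace H]
  (I : ModelWithCorners ℝ E H) (M : Type*) [TopologicalSpace M] [ChartedSpace H M]

/-- The cotangent bundle `T^*M`, with Mathlib's smooth structure on bundles of linear maps. -/
abbrev CotangentBundle : Type _ :=
  TotalSpace (E →L[ℝ] ℝ) (fun x : M => TangentSpace I x →L[ℝ] ℝ)

variable [IsManifold I ∞ M]

/-- The Liouville `1`-form on `T^*M`: `θ_α(u) = α(T π_M u)` for `π_M : T^*M → M`. -/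
def liouvilleForm : DiffForm (I.prod 𝓘(ℝ, E →L[ℝ] ℝ)) (CotangentBundle I M) 1 := fun α =>
  ContinuousAlternatingMap.ofSubsingleton ℝ _ ℝ (0 : Fin 1)
    (α.2.comp (mfderiv (I.prod 𝓘(ℝ, E →L[ℝ] ℝ)) I
      (TotalSpace.proj : CotangentBundle I M → M) α))

/-- The canonical symplectic form `Ω_M = -dθ` on `T^*M`, i.e. `∑ dqⁱ ∧ dpᵢ` in coordinates. -/
def canonicalForm : DiffForm (I.prod 𝓘(ℝ, E →L[ℝ] ℝ)) (CotangentBundle I M) 2 := fun α =>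
  -(liouvilleForm I M).d α

variable {M}

/-- The cotangent lift of an action `φ` of a group on `M`:
`T^*φ_g(α) = α ∘ (T_x φ_g)⁻¹ ∈ T^*_{φ_g(x)} M` for `α ∈ T^*_x M`. -/
def cotangentLift {G : Type*} (φ : G → M → M) (g : G) (α : CotangentBundle I M) :
    CotangentBundle I M :=
  ⟨φ g α.1, α.2.comp (mfderiv I I (φ g) α.1).inverse⟩

end Cotangent

/-! ### Fibrations over `ℝ`, the vertical bundle and its dual -/

/-- A surjective submersion `M → ℝ` (of class `C^∞`). -/
structure FibrationOverReal {E : Type*} [NormedAddCommGroup E] [NormedSpace ℝ E] {H : Type*}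
    [TopologicalSpace H] (I : ModelWithCorners ℝ E H) (M : Type*) [TopologicalSpace M]
    [ChartedSpace H M] where
  toFun : M → ℝ
  contMDiff : ContMDiff I 𝓘(ℝ, ℝ) ∞ toFun
  surjective : Function.Surjective toFun
  submersion : ∀ x : M, Function.Surjective (mfderiv I 𝓘(ℝ, ℝ) toFun x)

namespace FibrationOverReal
variable {E : Type*} [NormedAddCommGroup E] [NormedSpace ℝ E] {H : Type*} [TopologicalSpace H]
  {I : ModelWithCorners ℝ E H} {M : Type*} [TopologicalSpace M] [ChartedSpace H M]
  (p : FibrationOverReal I M)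

/-- The `1`-form `π^*(dt)` on `M`, i.e. the differential of `π`. -/
def dt (x : M) : TangentSpace I x →L[ℝ] ℝ := mfderiv I 𝓘(ℝ, ℝ) p.toFun x

/-- The fibre `V_xπ = ker T_xπ` of the vertical bundle of `π`. -/
def VerticalSpace (x : M) : Type _ := LinearMap.ker (p.dt x).toLinearMap

instance (x : M) : AddCommGroup (p.VerticalSpace x) :=
  inferInstanceAs (AddCommGroup (LinearMap.ker (p.dt x).toLinearMap))
instance (x : M) : Module ℝ (p.VerticalSpace x) :=
  inferInstanceAs (Module ℝ (LinearMap.ker (p.dt x).toLinearMap))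
instance (x : M) : TopologicalSpace (p.VerticalSpace x) :=
  inferInstanceAs (TopologicalSpace (LinearMap.ker (p.dt x).toLinearMap))
instance (x : M) : IsTopologicalAddGroup (p.VerticalSpace x) :=
  inferInstanceAs (IsTopologicalAddGroup (LinearMap.ker (p.dt x).toLinearMap))
instance (x : M) : ContinuousSMul ℝ (p.VerticalSpace x) :=
  inferInstanceAs (ContinuousSMul ℝ (LinearMap.ker (p.dt x).toLinearMap))

/-- The inclusion `Vπ → TM`. -/
def incl (x : M) : p.VerticalSpace x →L[ℝ] TangentSpace I x :=
  (LinearMap.ker (p.dt x).toLinearMap).subtypeL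


theorem incl_injective (x : M) : Function.Injective (p.incl x) := Subtype.val_injective

theorem dt_incl (x : M) (w : p.VerticalSpace x) : p.dt x (p.incl x w) = 0 := w.2

variable [FiniteDimensional ℝ E] [IsManifold I ∞ M]

set_option linter.unusedSectionVars false

/-- The model fibre of the vertical bundle. -/
abbrev VerticalModel (E : Type*) [NormedAddCommGroup E] [NormedSpace ℝ E] : Type :=
  EuclideanSpace ℝ (Fin (finrank ℝ E - 1))

theorem exists_splitting (f : E →L[ℝ] ℝ) (hf : f ≠ 0) :
    ∃ L : E ≃L[ℝ] ℝ × VerticalModel E, ∀ w, (L w).1 = f w := by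
  have hf' : f.toLinearMap ≠ 0 := fun h => hf (ContinuousLinearMap.coe_injective h)
  have hsurj : Function.Surjective f.toLinearMap := LinearMap.surjective hf'
  obtain ⟨g, hg⟩ := f.toLinearMap.exists_rightInverse_of_surjective
    (LinearMap.range_eq_top.2 hsurj)
  have hdim : finrank ℝ (LinearMap.ker f.toLinearMap) = finrank ℝ (VerticalModel E) := by
    have h1 := LinearMap.finrank_range_add_finrank_ker f.toLinearMap
    rw [LinearMap.range_eq_top.2 hsurj, finrank_top, finrank_self] at h1
    rw [finrank_euclideanSpace_fin]
    omega
  have hfg : ∀ t, f (g t) = t := fun t => LinearMap.congr_fun hg t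
  let K := LinearEquiv.ofFinrankEq _ _ hdim
  let P : E →ₗ[ℝ] LinearMap.ker f.toLinearMap :=
    LinearMap.codRestrict _ (LinearMap.id - g ∘ₗ f.toLinearMap) (fun w => by
      simp [LinearMap.mem_ker, hfg])
  let L : E →ₗ[ℝ] ℝ × VerticalModel E := f.toLinearMap.prod (K.toLinearMap ∘ₗ P)
  have hinj : Function.Injective L := by
    rw [← LinearMap.ker_eq_bot, LinearMap.ker_eq_bot']
    intro w hw
    have h1 : f w = 0 := congrArg Prod.fst hw
    have h2 : K (P w) = 0 := congrArg Prod.snd hw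
    have h3 : P w = 0 := by simpa using h2
    have h4 : ((P w : LinearMap.ker f.toLinearMap) : E) = 0 := by rw [h3]; rfl
    simpa [P, h1] using h4
  have hd : finrank ℝ E = finrank ℝ (ℝ × VerticalModel E) := by
    have h1 := LinearMap.finrank_range_add_finrank_ker f.toLinearMap
    rw [LinearMap.range_eq_top.2 hsurj, finrank_top, finrank_self] at h1
    rw [finrank_prod, finrank_self, ← hdim]
    omega
  exact ⟨(LinearEquiv.ofInjectiveOfFinrankEq L hinj hd).toContinuousLinearEquiv, fun w => rfl⟩

/-- `dπ` read in the local trivialization of `TM` around `x₀`. -/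
def dtCoord (x₀ x : M) : E →L[ℝ] ℝ :=
  (p.dt x).comp ((trivializationAt E (TangentSpace I) x₀).symmL ℝ x)

theorem dtCoord_apply_coord {x₀ x : M} (hx : x ∈ (trivializationAt E (TangentSpace I) x₀).baseSet)
    (u : TangentSpace I x) :
    p.dtCoord x₀ x ((trivializationAt E (TangentSpace I) x₀).continuousLinearMapAt ℝ x u) =
      p.dt x u := by
  simp only [dtCoord, ContinuousLinearMap.comp_apply]
  rw [Trivialization.symmL_continuousLinearMapAt _ hx]

theorem dtCoord_self_ne_zero (x₀ : M) : p.dtCoord x₀ x₀ ≠ 0 := by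
  intro h
  obtain ⟨u, hu⟩ := p.submersion x₀ (1 : ℝ)
  have h1 := p.dtCoord_apply_coord (FiberBundle.mem_baseSet_trivializationAt' x₀) u
  rw [h] at h1
  have h2 : p.dt x₀ u = (1 : ℝ) := hu
  rw [h2] at h1
  simp at h1

theorem contMDiffOn_dtCoord (x₀ : M) :
    ContMDiffOn I 𝓘(ℝ, E →L[ℝ] ℝ) ∞ (p.dtCoord x₀)
      (trivializationAt E (TangentSpace I) x₀).baseSet := by
  intro x₁ hx₁
  apply ContMDiffAt.contMDiffWithinAt
  have hx₁' : x₁ ∈ (trivializationAt E (TangentSpace I) x₁).baseSet :=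
    FiberBundle.mem_baseSet_trivializationAt' x₁
  have h1 : ContMDiffAt I 𝓘(ℝ, E →L[ℝ] ℝ) ∞ (p.dtCoord x₁) x₁ := by
    have h := (p.contMDiff x₁).mfderiv_const (m := ∞) (n := ∞) le_rfl
    refine h.congr_of_eventuallyEq (Filter.Eventually.of_forall fun x => ?_)
    simp only [inTangentCoordinates, ContinuousLinearMap.inCoordinates, dtCoord, dt]
    ext v
    simp only [TangentBundle.continuousLinearMapAt_model_space]
    rfl
  have h2 : ContMDiffAt I 𝓘(ℝ, E →L[ℝ] E) ∞
      (fun b : M => ((trivializationAt E (TangentSpace I) x₀).coordChangeL ℝ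
        (trivializationAt E (TangentSpace I) x₁) b : E →L[ℝ] E)) x₁ :=
    contMDiffAt_coordChangeL hx₁ hx₁'
  refine (h1.clm_comp h2).congr_of_eventuallyEq ?_
  filter_upwards [(trivializationAt E (TangentSpace I) x₀).open_baseSet.mem_nhds hx₁,
    (trivializationAt E (TangentSpace I) x₁).open_baseSet.mem_nhds hx₁'] with b hb hb'
  ext v
  simp only [ContinuousLinearMap.comp_apply, ContinuousLinearEquiv.coe_coe]
  rw [Trivialization.coordChangeL_apply _ _ ⟨hb, hb'⟩]
  have := p.dtCoord_apply_coord hb' ((trivializationAt E (TangentSpace I) x₀).symm b v)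
  rw [Trivialization.continuousLinearMapAt_apply, Trivialization.linearMapAt_apply,
    if_pos hb'] at this
  rw [this, dtCoord, ContinuousLinearMap.comp_apply, Trivialization.symmL_apply _ hb]

/-- A splitting `E ≃ ℝ × F` whose first component is `dπ` at `x₀`. -/
def splitting (x₀ : M) : E ≃L[ℝ] ℝ × VerticalModel E :=
  Classical.choose (exists_splitting _ (p.dtCoord_self_ne_zero x₀))

theorem splitting_fst (x₀ : M) (w : E) : (p.splitting x₀ w).1 = p.dtCoord x₀ x₀ w :=
  Classical.choose_spec (exists_splitting _ (p.dtCoord_self_ne_zero x₀)) w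

/-- `dπ(∂_t)` for the chosen transversal direction `∂_t`. -/
def transv (x₀ x : M) : ℝ := p.dtCoord x₀ x ((p.splitting x₀).symm (1, 0))

theorem transv_self (x₀ : M) : p.transv x₀ x₀ = 1 := by
  rw [transv, ← p.splitting_fst, ContinuousLinearEquiv.apply_symm_apply]

/-- The inverse of the trivialization of the vertical bundle, in the coordinates of `TM`. -/
def verticalLift (x₀ x : M) : VerticalModel E →L[ℝ] E :=
  let A : VerticalModel E →L[ℝ] E :=
    ((p.splitting x₀).symm : ℝ × VerticalModel E →L[ℝ] E).comp
      (ContinuousLinearMap.inr ℝ ℝ (VerticalModel E))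
  (p.transv x₀ x)⁻¹ • (p.transv x₀ x • A -
    ((p.dtCoord x₀ x).comp A).smulRight ((p.splitting x₀).symm (1, 0)))

theorem dtCoord_verticalLift (x₀ x : M) (f : VerticalModel E) :
    p.dtCoord x₀ x (p.verticalLift x₀ x f) = 0 := by
  have h : p.dtCoord x₀ x ((p.splitting x₀).symm (1, 0)) = p.transv x₀ x := rfl
  simp [verticalLift, h, mul_comm]

theorem splitting_verticalLift {x₀ x : M} (hx : p.transv x₀ x ≠ 0) (f : VerticalModel E) :
    (p.splitting x₀ (p.verticalLift x₀ x f)).2 = f := by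
  simp [verticalLift, smul_smul, hx]

theorem verticalLift_splitting {x₀ x : M} (hx : p.transv x₀ x ≠ 0) (u : E)
    (hu : p.dtCoord x₀ x u = 0) :
    p.verticalLift x₀ x (p.splitting x₀ u).2 = u := by
  have key : u = (p.splitting x₀ u).1 • (p.splitting x₀).symm (1, 0) +
      (p.splitting x₀).symm (0, (p.splitting x₀ u).2) := by
    rw [← map_smul, ← map_add]
    simp
  have h1 : p.dtCoord x₀ x ((p.splitting x₀).symm (0, (p.splitting x₀ u).2)) =
      - ((p.splitting x₀ u).1 * p.transv x₀ x) := by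
    have := congrArg (p.dtCoord x₀ x) key
    rw [hu, map_add, map_smul, smul_eq_mul] at this
    rw [transv]
    linarith
  conv_rhs => rw [key]
  simp [verticalLift, h1, hx, smul_smul, smul_sub, add_comm, mul_comm]

/-- The local trivialization of the vertical bundle around `x₀`. -/
def verticalPretrivialization (x₀ : M) :
    Pretrivialization (VerticalModel E) (π (VerticalModel E) p.VerticalSpace) where
  toFun q := ⟨q.1, (p.splitting x₀
    ((trivializationAt E (TangentSpace I) x₀).continuousLinearMapAt ℝ q.1 (p.incl q.1 q.2))).2⟩
  invFun q := ⟨q.1, ⟨(trivializationAt E (TangentSpace I) x₀).symmL ℝ q.1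
    (p.verticalLift x₀ q.1 q.2), p.dtCoord_verticalLift x₀ q.1 q.2⟩⟩
  source := TotalSpace.proj ⁻¹' ((trivializationAt E (TangentSpace I) x₀).baseSet ∩
    p.transv x₀ ⁻¹' {0}ᶜ)
  target := ((trivializationAt E (TangentSpace I) x₀).baseSet ∩ p.transv x₀ ⁻¹' {0}ᶜ) ×ˢ univ
  baseSet := (trivializationAt E (TangentSpace I) x₀).baseSet ∩ p.transv x₀ ⁻¹' {0}ᶜ
  open_baseSet := by
    refine ContinuousOn.isOpen_inter_preimage ?_
      (trivializationAt E (TangentSpace I) x₀).open_baseSet isOpen_compl_singleton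
    exact (p.contMDiffOn_dtCoord x₀).continuousOn.clm_apply continuousOn_const
  open_target := by
    refine IsOpen.prod (ContinuousOn.isOpen_inter_preimage ?_
      (trivializationAt E (TangentSpace I) x₀).open_baseSet isOpen_compl_singleton) isOpen_univ
    exact (p.contMDiffOn_dtCoord x₀).continuousOn.clm_apply continuousOn_const
  source_eq := rfl
  target_eq := rfl
  proj_toFun _ _ := rfl
  map_source' := fun ⟨_, _⟩ h ↦ ⟨h, mem_univ _⟩
  map_target' := fun ⟨_, _⟩ h ↦ h.1
  left_inv' := fun ⟨x, w⟩ ⟨h₁, h₂⟩ ↦ by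
    refine congrArg (TotalSpace.mk x) (p.incl_injective x ?_)
    change (trivializationAt E (TangentSpace I) x₀).symmL ℝ x (p.verticalLift x₀ x _) = p.incl x w
    rw [p.verticalLift_splitting h₂, Trivialization.symmL_continuousLinearMapAt _ h₁]
    rw [p.dtCoord_apply_coord h₁, p.dt_incl]
  right_inv' := fun ⟨x, f⟩ ⟨⟨h₁, h₂⟩, _⟩ ↦ by
    simp only [Prod.mk.injEq, true_and]
    change (p.splitting x₀ ((trivializationAt E (TangentSpace I) x₀).continuousLinearMapAt ℝ x
      ((trivializationAt E (TangentSpace I) x₀).symmL ℝ x (p.verticalLift x₀ x f)))).2 = f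
    rw [Trivialization.continuousLinearMapAt_symmL _ h₁, p.splitting_verticalLift h₂]

/-- The coordinate changes between the local trivializations of the vertical bundle. -/
def verticalCoordChange (x₀ x₁ x : M) : VerticalModel E →L[ℝ] VerticalModel E :=
  ((ContinuousLinearMap.snd ℝ ℝ (VerticalModel E)).comp
    (p.splitting x₁ : E →L[ℝ] ℝ × VerticalModel E)).comp
    (((trivializationAt E (TangentSpace I) x₀).coordChangeL ℝ
      (trivializationAt E (TangentSpace I) x₁) x : E →L[ℝ] E).comp (p.verticalLift x₀ x))

theorem contMDiffOn_verticalLift (x₀ : M) :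
    ContMDiffOn I 𝓘(ℝ, VerticalModel E →L[ℝ] E) ∞ (p.verticalLift x₀)
      (p.verticalPretrivialization x₀).baseSet := by
  have hd : ContMDiffOn I 𝓘(ℝ, E →L[ℝ] ℝ) ∞ (p.dtCoord x₀)
      (p.verticalPretrivialization x₀).baseSet :=
    (p.contMDiffOn_dtCoord x₀).mono inter_subset_left
  have ht : ContMDiffOn I 𝓘(ℝ, ℝ) ∞ (p.transv x₀)
      (p.verticalPretrivialization x₀).baseSet := hd.clm_apply contMDiffOn_const
  have hti : ContMDiffOn I 𝓘(ℝ, ℝ) ∞ (fun x => (p.transv x₀ x)⁻¹)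
      (p.verticalPretrivialization x₀).baseSet := ht.inv₀ fun x hx => hx.2
  refine hti.smul ((ht.smul contMDiffOn_const).sub ?_)
  have h1 := hd.clm_comp (contMDiffOn_const
    (c := ((p.splitting x₀).symm : ℝ × VerticalModel E →L[ℝ] E).comp
      (ContinuousLinearMap.inr ℝ ℝ (VerticalModel E))))
  exact (ContinuousLinearMap.contMDiff
    ((ContinuousLinearMap.smulRightL ℝ (VerticalModel E) E).flip
      ((p.splitting x₀).symm (1, 0)))).comp_contMDiffOn h1

theorem contMDiffOn_verticalCoordChange (x₀ x₁ : M) :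
    ContMDiffOn I 𝓘(ℝ, VerticalModel E →L[ℝ] VerticalModel E) ∞ (p.verticalCoordChange x₀ x₁)
      ((p.verticalPretrivialization x₀).baseSet ∩ (p.verticalPretrivialization x₁).baseSet) := by
  refine contMDiffOn_const.clm_comp (ContMDiffOn.clm_comp ?_
    ((p.contMDiffOn_verticalLift x₀).mono inter_subset_left))
  exact (contMDiffOn_coordChangeL _ _).mono fun x hx => ⟨hx.1.1, hx.2.1⟩

theorem verticalCoordChange_apply (x₀ x₁ : M) {x : M}
    (hx : x ∈ (p.verticalPretrivialization x₀).baseSet ∩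
      (p.verticalPretrivialization x₁).baseSet) (f : VerticalModel E) :
    p.verticalCoordChange x₀ x₁ x f =
      (p.verticalPretrivialization x₁ ⟨x, (p.verticalPretrivialization x₀).symm x f⟩).2 := by
  rw [Pretrivialization.mk_symm _ hx.1]
  change (p.splitting x₁ ((trivializationAt E (TangentSpace I) x₀).coordChangeL ℝ
      (trivializationAt E (TangentSpace I) x₁) x (p.verticalLift x₀ x f))).2 =
    (p.splitting x₁ ((trivializationAt E (TangentSpace I) x₁).continuousLinearMapAt ℝ x
      ((trivializationAt E (TangentSpace I) x₀).symmL ℝ x (p.verticalLift x₀ x f)))).2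
  rw [Trivialization.coordChangeL_apply _ _ ⟨hx.1.1, hx.2.1⟩,
    Trivialization.continuousLinearMapAt_apply, Trivialization.linearMapAt_apply, if_pos hx.2.1, Trivialization.symmL_apply _ hx.1.1]

theorem verticalPretrivialization_isInducing (x₀ : M) :
    IsInducing (p.verticalPretrivialization x₀ ∘ TotalSpace.mk x₀) := by
  have hx₀ : x₀ ∈ (trivializationAt E (TangentSpace I) x₀).baseSet :=
    FiberBundle.mem_baseSet_trivializationAt' x₀
  let K : TangentSpace I x₀ ≃L[ℝ] ℝ × VerticalModel E :=
    ((trivializationAt E (TangentSpace I) x₀).continuousLinearEquivAt ℝ x₀ hx₀).trans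
      (p.splitting x₀)
  have hK : ∀ u : TangentSpace I x₀, K u = p.splitting x₀
      ((trivializationAt E (TangentSpace I) x₀).continuousLinearMapAt ℝ x₀ u) := fun u =>
    congrArg (p.splitting x₀)
      (congrFun (Trivialization.coe_continuousLinearEquivAt_eq _ hx₀) u)
  have h1 : IsInducing fun w : p.VerticalSpace x₀ => K (p.incl x₀ w) :=
    K.toHomeomorph.isInducing.comp IsInducing.subtypeVal
  have h2 : IsInducing fun w : p.VerticalSpace x₀ => (K (p.incl x₀ w)).2 := by
    have h3 : (fun w : p.VerticalSpace x₀ => K (p.incl x₀ w)) =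
        (fun f : VerticalModel E => ((0 : ℝ), f)) ∘ fun w => (K (p.incl x₀ w)).2 := by
      funext w
      refine Prod.ext ?_ rfl
      change (K (p.incl x₀ w)).1 = 0
      rw [hK, p.splitting_fst]
      exact (p.dtCoord_apply_coord hx₀ _).trans (p.dt_incl x₀ w)
    rw [h3] at h1
    exact IsInducing.of_comp (continuous_snd.comp (K.continuous.comp (p.incl x₀).continuous))
      (by fun_prop) h1
  have h4 := isInducing_const_prod (x := x₀).mpr h2
  convert h4 using 1
  funext w
  refine Prod.ext rfl ?_
  change (p.splitting x₀ _).2 = (K (p.incl x₀ w)).2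
  rw [hK]

/-- The vertical bundle `Vπ` as a vector bundle over `M`. -/
def verticalPrebundle : VectorPrebundle ℝ (VerticalModel E) p.VerticalSpace where
  pretrivializationAtlas := range p.verticalPretrivialization
  pretrivialization_linear' := by
    rintro _ ⟨x₀, rfl⟩
    exact ⟨fun x _ =>
      (((ContinuousLinearMap.snd ℝ ℝ (VerticalModel E)).comp
        (p.splitting x₀ : E →L[ℝ] ℝ × VerticalModel E)).comp
        (((trivializationAt E (TangentSpace I) x₀).continuousLinearMapAt ℝ x).comp
          (p.incl x))).toLinearMap.isLinear⟩
  pretrivializationAt := p.verticalPretrivialization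
  mem_base_pretrivializationAt x := by
    refine ⟨FiberBundle.mem_baseSet_trivializationAt' x, ?_⟩
    simp [transv_self]
  pretrivialization_mem_atlas x := mem_range_self x
  exists_coordChange := by
    rintro _ ⟨x₀, rfl⟩ _ ⟨x₁, rfl⟩
    exact ⟨p.verticalCoordChange x₀ x₁, (p.contMDiffOn_verticalCoordChange x₀ x₁).continuousOn,
      fun _ hb f => p.verticalCoordChange_apply x₀ x₁ hb f⟩
  totalSpaceMk_isInducing := p.verticalPretrivialization_isInducing

instance : TopologicalSpace (TotalSpace (VerticalModel E) p.VerticalSpace) :=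
  p.verticalPrebundle.totalSpaceTopology

instance : FiberBundle (VerticalModel E) p.VerticalSpace := p.verticalPrebundle.toFiberBundle

instance : VectorBundle ℝ (VerticalModel E) p.VerticalSpace := p.verticalPrebundle.toVectorBundle

instance : p.verticalPrebundle.IsContMDiff I ∞ where
  exists_contMDiffCoordChange := by
    rintro _ ⟨x₀, rfl⟩ _ ⟨x₁, rfl⟩
    exact ⟨p.verticalCoordChange x₀ x₁, p.contMDiffOn_verticalCoordChange x₀ x₁,
      fun _ hb f => p.verticalCoordChange_apply x₀ x₁ hb f⟩

instance : ContMDiffVectorBundle ∞ (VerticalModel E) p.VerticalSpace I :=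
  p.verticalPrebundle.contMDiffVectorBundle I

/-- The bundle `V^*π`, dual to the vertical bundle. -/
abbrev DualVerticalBundle : Type _ :=
  TotalSpace (VerticalModel E →L[ℝ] ℝ) (fun x : M => p.VerticalSpace x →L[ℝ] ℝ)

/-- The projection `μ_π : T^*M → V^*π`, dual to the inclusion `Vπ → TM`. -/
def mu (α : CotangentBundle I M) : p.DualVerticalBundle := ⟨α.1, α.2.comp (p.incl α.1)⟩

/-- The principal action `ψ_π(s, α) = α + s π^*(dt)(x)`, for `α ∈ T^*_x M`. -/
def psi (s : ℝ) (α : CotangentBundle I M) : CotangentBundle I M := ⟨α.1, α.2 + s • p.dt α.1⟩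

end FibrationOverReal

end

noncomputable section

namespace DiffForm

variable {F : Type*} [NormedAddCommGroup F] [NormedSpace ℝ F] {K : Type*} [TopologicalSpace K]
  {J : ModelWithCorners ℝ F K} {N : Type*} [TopologicalSpace N] [ChartedSpace K N] {k : ℕ}
  {F' : Type*} [NormedAddCommGroup F'] [NormedSpace ℝ F']

/-- The differential of a map into a normed space, with values in that space. -/
def differential (J : ModelWithCorners ℝ F K) (g : N → F') (x : N) : TangentSpace J x →L[ℝ] F' :=
  mfderiv J 𝓘(ℝ, F') g x

/-- The pullback of a form on the normed space `F'` by a map `g : N → F'`. -/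
def pullFrom (J : ModelWithCorners ℝ F K) (g : N → F') (β : F' → F' [⋀^Fin k]→L[ℝ] ℝ) :
    DiffForm J N k :=
  fun x => (β (g x)).compContinuousLinearMap (differential J g x)

theorem pullFrom_apply (g : N → F') (β : F' → F' [⋀^Fin k]→L[ℝ] ℝ) (x : N)
    (v : Fin k → TangentSpace J x) :
    pullFrom J g β x v = β (g x) (fun i => differential J g x (v i)) := rfl

theorem pullback_pullFrom {f : N → N} {g : N → F'} {β : F' → F' [⋀^Fin k]→L[ℝ] ℝ}
    {η : DiffForm J N k} {x : N} (hη : η (f x) = pullFrom J g β (f x))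
    (hg : MDifferentiableAt J 𝓘(ℝ, F') g (f x)) (hf : MDifferentiableAt J J f x) :
    η.pullback f x = pullFrom J (g ∘ f) β x := by
  rw [pullback, hη, pullFrom, pullFrom, differential, differential, mfderiv_comp x hg hf]
  rfl

variable [J.Boundaryless] [IsManifold J ∞ N]

theorem mdifferentiableAt_extChartAt_symm {x₀ : N} {z : F} (hz : z ∈ (extChartAt J x₀).target) :
    MDifferentiableAt 𝓘(ℝ, F) J (extChartAt J x₀).symm z := by
  have h := (contMDiffOn_extChartAt_symm (I := J) (n := ∞) x₀).contMDiffAt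
    ((isOpen_extChartAt_target x₀).mem_nhds hz)
  exact h.mdifferentiableAt (by simp)

theorem inChart_pullFrom {g : N → F'} {β : F' → F' [⋀^Fin k]→L[ℝ] ℝ} {η : DiffForm J N k}
    {x₀ : N} {z : F} (hz : z ∈ (extChartAt J x₀).target)
    (hg : MDifferentiableAt J 𝓘(ℝ, F') g ((extChartAt J x₀).symm z))
    (hη : η ((extChartAt J x₀).symm z) = pullFrom J g β ((extChartAt J x₀).symm z)) :
    η.inChart x₀ z = (β (g ((extChartAt J x₀).symm z))).compContinuousLinearMap
      (fderiv ℝ (g ∘ (extChartAt J x₀).symm) z) := by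
  have h1 := mfderiv_comp z hg (mdifferentiableAt_extChartAt_symm hz)
  rw [mfderiv_eq_fderiv] at h1
  rw [h1]
  ext v
  simp only [inChart, hη, J.range_eq_univ, mfderivWithin_univ]
  rfl

theorem d_pullFrom {g : N → F'} {β : F' → F' [⋀^Fin k]→L[ℝ] ℝ} {η : DiffForm J N k} {x : N}
    (hg : ContMDiffAt J 𝓘(ℝ, F') ∞ g x) (hβ : DifferentiableAt ℝ β (g x))
    (hη : ∀ᶠ y in 𝓝 x, η y = pullFrom J g β y) :
    η.d x = pullFrom J g (extDeriv β) x := by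
  have hsymm : ContinuousAt (extChartAt J x).symm (extChartAt J x x) :=
    continuousAt_extChartAt_symm x
  have hgn : ∀ᶠ y in 𝓝 x, ContMDiffAt J 𝓘(ℝ, F') 1 g y :=
    contMDiffAt_iff_contMDiffAt_nhds (by simp) |>.1 (hg.of_le (by exact_mod_cast le_top))
  have hx : (extChartAt J x).symm (extChartAt J x x) = x := extChartAt_to_inv x
  have ev : η.inChart x =ᶠ[𝓝 (extChartAt J x x)]
      fun z => (β ((g ∘ (extChartAt J x).symm) z)).compContinuousLinearMap
        (fderiv ℝ (g ∘ (extChartAt J x).symm) z) := by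
    have h1 : ∀ᶠ z in 𝓝 (extChartAt J x x), z ∈ (extChartAt J x).target :=
      extChartAt_target_mem_nhds x
    rw [ContinuousAt, hx] at hsymm
    filter_upwards [h1, hsymm.eventually hgn, hsymm.eventually hη] with z hz hz1 hz2
    exact inChart_pullFrom hz (hz1.mdifferentiableAt (by simp)) hz2
  have hgs : ContDiffAt ℝ ∞ (g ∘ (extChartAt J x).symm) (extChartAt J x x) := by
    rw [← contMDiffAt_iff_contDiffAt]
    refine ContMDiffAt.comp _ (by rwa [hx]) ?_
    exact (contMDiffOn_extChartAt_symm x).contMDiffAt (extChartAt_target_mem_nhds x)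
  have h2 := extDeriv_pullback (f := g ∘ (extChartAt J x).symm) (x := extChartAt J x x)
    (show DifferentiableAt ℝ β ((g ∘ (extChartAt J x).symm) (extChartAt J x x)) by
      simpa [hx] using hβ) hgs
    (by simpa using WithTop.coe_le_coe.2 (le_top : (2 : ℕ∞) ≤ ⊤))
  have hmd : MDifferentiableAt J 𝓘(ℝ, F) (extChartAt J x) x :=
    mdifferentiableAt_extChartAt (mem_chart_source K x)
  have h3 : mfderiv J 𝓘(ℝ, F') g x =
      (fderiv ℝ (g ∘ (extChartAt J x).symm) (extChartAt J x x)).comp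
        (mfderiv J 𝓘(ℝ, F) (extChartAt J x) x : TangentSpace J x →L[ℝ] F) := by
    have h4 : g =ᶠ[𝓝 x] (g ∘ (extChartAt J x).symm) ∘ extChartAt J x := by
      filter_upwards [extChartAt_source_mem_nhds (I := J) x] with y hy
      simp only [Function.comp_apply, (extChartAt J x).left_inv hy]
    rw [h4.mfderiv_eq, ← mfderiv_eq_fderiv]
    exact mfderiv_comp x (hgs.differentiableAt (by simp)).mdifferentiableAt hmd
  rw [d, J.range_eq_univ, extDerivWithin_univ, ev.extDeriv_eq, h2]
  rw [pullFrom, differential, h3, Function.comp_apply, hx]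
  rfl

theorem inChart_of_pullFrom_extChartAt {β : F → F [⋀^Fin k]→L[ℝ] ℝ} {η : DiffForm J N k}
    {x₀ : N} (hη : ∀ y ∈ (chartAt K x₀).source, η y = pullFrom J (extChartAt J x₀) β y)
    {z : F} (hz : z ∈ (extChartAt J x₀).target) : η.inChart x₀ z = β z := by
  have hs : (extChartAt J x₀).symm z ∈ (chartAt K x₀).source := by
    simpa using (extChartAt J x₀).map_target hz
  rw [inChart_pullFrom hz (mdifferentiableAt_extChartAt hs) (hη _ hs)]
  have h1 : (extChartAt J x₀) ∘ (extChartAt J x₀).symm =ᶠ[𝓝 z] id := by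
    filter_upwards [(isOpen_extChartAt_target x₀).mem_nhds hz] with y hy
    exact (extChartAt J x₀).right_inv hy
  rw [h1.fderiv_eq, (extChartAt J x₀).right_inv hz, fderiv_id]
  ext v
  rfl

end DiffForm

/-- The exterior derivative of a `1`-form on a normed space. -/
theorem extDeriv_one_apply {F : Type*} [NormedAddCommGroup F] [NormedSpace ℝ F]
    {β : F → F [⋀^Fin 1]→L[ℝ] ℝ} {x : F} (v : Fin 2 → F) :
    extDeriv β x v = fderiv ℝ β x (v 0) ![v 1] - fderiv ℝ β x (v 1) ![v 0] := by
  rw [extDeriv, ContinuousAlternatingMap.alternatizeUncurryFin_apply, Fin.sum_univ_two]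
  have h0 : Fin.removeNth 0 v = ![v 1] := by ext i; fin_cases i; rfl
  have h1 : Fin.removeNth 1 v = ![v 0] := by ext i; fin_cases i; rfl
  simp [h0, h1, sub_eq_add_neg]

section Dual

variable {B : Type*} [TopologicalSpace B] {F₁ : Type*} [NormedAddCommGroup F₁] [NormedSpace ℝ F₁]
  {E₁ : B → Type*} [∀ x, AddCommGroup (E₁ x)] [∀ x, Module ℝ (E₁ x)]
  [∀ x, TopologicalSpace (E₁ x)] [TopologicalSpace (TotalSpace F₁ E₁)]
  [FiberBundle F₁ E₁] [VectorBundle ℝ F₁ E₁]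

theorem dual_trivializationAt_apply (x₀ : B)
    (α : TotalSpace (F₁ →L[ℝ] ℝ) (fun x => E₁ x →L[ℝ] ℝ)) :
    trivializationAt (F₁ →L[ℝ] ℝ) (fun x => E₁ x →L[ℝ] ℝ) x₀ α =
      (α.1, α.2.comp ((trivializationAt F₁ E₁ x₀).symmL ℝ α.1)) := by
  rw [hom_trivializationAt_apply]
  refine Prod.ext rfl ?_
  ext v
  simp [ContinuousLinearMap.inCoordinates]

theorem dual_trivializationAt_baseSet (x₀ : B) :
    (trivializationAt (F₁ →L[ℝ] ℝ) (fun x => E₁ x →L[ℝ] ℝ) x₀).baseSet =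
      (trivializationAt F₁ E₁ x₀).baseSet := by
  rw [hom_trivializationAt_baseSet]
  exact inter_univ _

variable {EB : Type*} [NormedAddCommGroup EB] [NormedSpace ℝ EB] {HB : Type*} [TopologicalSpace HB]
  {IB : ModelWithCorners ℝ EB HB} [ChartedSpace HB B] [ContMDiffVectorBundle ∞ F₁ E₁ IB]
  {EN : Type*} [NormedAddCommGroup EN] [NormedSpace ℝ EN] {HN : Type*} [TopologicalSpace HN]
  {IN : ModelWithCorners ℝ EN HN} {N : Type*} [TopologicalSpace N] [ChartedSpace HN N]

theorem contMDiffWithinAt_dual_iff {f : N → TotalSpace (F₁ →L[ℝ] ℝ) (fun x => E₁ x →L[ℝ] ℝ)}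
    {s : Set N} {a : N} {x₀ : B} (ha : (f a).1 ∈ (trivializationAt F₁ E₁ x₀).baseSet) :
    ContMDiffWithinAt IN (IB.prod 𝓘(ℝ, F₁ →L[ℝ] ℝ)) ∞ f s a ↔
      ContMDiffWithinAt IN IB ∞ (fun b => (f b).1) s a ∧
      ContMDiffWithinAt IN 𝓘(ℝ, F₁ →L[ℝ] ℝ) ∞
        (fun b => ((f b).2.comp ((trivializationAt F₁ E₁ x₀).symmL ℝ (f b).1) : F₁ →L[ℝ] ℝ))
        s a := by
  rw [Trivialization.contMDiffWithinAt_iff (IB := IB) (e := trivializationAt (F₁ →L[ℝ] ℝ)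
    (fun x => E₁ x →L[ℝ] ℝ) x₀)]
  · simp only [dual_trivializationAt_apply]
  · rw [Trivialization.mem_source, dual_trivializationAt_baseSet]
    exact ha

theorem contMDiffAt_dual_iff {f : N → TotalSpace (F₁ →L[ℝ] ℝ) (fun x => E₁ x →L[ℝ] ℝ)}
    {a : N} {x₀ : B} (ha : (f a).1 ∈ (trivializationAt F₁ E₁ x₀).baseSet) :
    ContMDiffAt IN (IB.prod 𝓘(ℝ, F₁ →L[ℝ] ℝ)) ∞ f a ↔
      ContMDiffAt IN IB ∞ (fun b => (f b).1) a ∧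
      ContMDiffAt IN 𝓘(ℝ, F₁ →L[ℝ] ℝ) ∞
        (fun b => ((f b).2.comp ((trivializationAt F₁ E₁ x₀).symmL ℝ (f b).1) : F₁ →L[ℝ] ℝ))
        a :=
  contMDiffWithinAt_dual_iff ha

end Dual

theorem extDeriv_fun_const {F : Type*} [NormedAddCommGroup F] [NormedSpace ℝ F] {k : ℕ}
    (β : F [⋀^Fin k]→L[ℝ] ℝ) (x : F) : extDeriv (fun _ => β) x = 0 := by
  ext v
  simp [extDeriv, ContinuousAlternatingMap.alternatizeUncurryFin_apply]

section Liouville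

variable {E : Type*} [NormedAddCommGroup E] [NormedSpace ℝ E]

/-- The Liouville form `p dq` of `E × E^*`. -/
def modelLiouville (E : Type*) [NormedAddCommGroup E] [NormedSpace ℝ E] :
    (E × (E →L[ℝ] ℝ)) →L[ℝ] ((E × (E →L[ℝ] ℝ)) [⋀^Fin 1]→L[ℝ] ℝ) :=
  ((ContinuousAlternatingMap.ofSubsingletonLIE (𝕜 := ℝ) (E := E × (E →L[ℝ] ℝ)) (F := ℝ)
    (0 : Fin 1)).toContinuousLinearEquiv : _ →L[ℝ] _).comp
    (((ContinuousLinearMap.compL ℝ (E × (E →L[ℝ] ℝ)) E ℝ).flip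
      (ContinuousLinearMap.fst ℝ E (E →L[ℝ] ℝ))).comp (ContinuousLinearMap.snd ℝ E (E →L[ℝ] ℝ)))

theorem modelLiouville_apply (z : E × (E →L[ℝ] ℝ)) (v : Fin 1 → E × (E →L[ℝ] ℝ)) :
    modelLiouville E z v = z.2 (v 0).1 := rfl

theorem extDeriv_modelLiouville (z : E × (E →L[ℝ] ℝ)) (v : Fin 2 → E × (E →L[ℝ] ℝ)) :
    extDeriv (modelLiouville E) z v = (v 0).2 (v 1).1 - (v 1).2 (v 0).1 := by
  rw [extDeriv_one_apply, ContinuousLinearMap.fderiv]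
  rfl

variable {H : Type*} [TopologicalSpace H]
  {I : ModelWithCorners ℝ E H} {M : Type*} [TopologicalSpace M] [ChartedSpace H M]
  [IsManifold I ∞ M]

local notation "J" => ModelWithCorners.prod I 𝓘(ℝ, E →L[ℝ] ℝ)

theorem extChartAt_cotangent_apply (α₀ α : CotangentBundle I M) :
    extChartAt J α₀ α = (extChartAt I α₀.1 α.1,
      α.2.comp ((trivializationAt E (TangentSpace I) α₀.1).symmL ℝ α.1)) := by
  rw [FiberBundle.extChartAt, PartialEquiv.coe_trans, Function.comp_apply]
  exact congrArg (fun q : M × (E →L[ℝ] ℝ) => (extChartAt I α₀.1 q.1, q.2))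
    (dual_trivializationAt_apply (E₁ := TangentSpace I) α₀.1 α)

theorem mem_chartAt_cotangent_source {α₀ α : CotangentBundle I M} :
    α ∈ (chartAt (ModelProd H (E →L[ℝ] ℝ)) α₀).source ↔ α.1 ∈ (chartAt H α₀.1).source := by
  rw [FiberBundle.chartedSpace_chartAt]
  simp only [mfld_simps]
  exact ⟨fun h => h.1.1, fun h => ⟨⟨h, trivial⟩, h⟩⟩

theorem mfderiv_extChartAt_cotangent_fst {α₀ α : CotangentBundle I M}
    (h : α.1 ∈ (chartAt H α₀.1).source) (u : TangentSpace J α) :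
    (DiffForm.differential J (extChartAt J α₀) α u).1 =
      (trivializationAt E (TangentSpace I) α₀.1).continuousLinearMapAt ℝ α.1
        (mfderiv J I (TotalSpace.proj : CotangentBundle I M → M) α u) := by
  have hm : MDifferentiableAt J 𝓘(ℝ, E × (E →L[ℝ] ℝ)) (extChartAt J α₀) α :=
    mdifferentiableAt_extChartAt (mem_chartAt_cotangent_source.2 h)
  have hp : MDifferentiableAt J I (TotalSpace.proj : CotangentBundle I M → M) α :=
    (Bundle.contMDiff_proj (n := ∞) _ α).mdifferentiableAt (by simp)
  have h1 := mfderiv_comp α (g := extChartAt I α₀.1) (mdifferentiableAt_extChartAt h) hp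
  have h2 := mfderiv_comp α (g := (Prod.fst : E × (E →L[ℝ] ℝ) → E)) (I' := 𝓘(ℝ, E × (E →L[ℝ] ℝ)))
    (I'' := 𝓘(ℝ, E)) differentiableAt_fst.mdifferentiableAt hm
  have h3 : Prod.fst ∘ extChartAt J α₀ = extChartAt I α₀.1 ∘ TotalSpace.proj := by
    funext β
    rw [Function.comp_apply, extChartAt_cotangent_apply]; rfl
  rw [h3, h1, mfderiv_eq_fderiv, fderiv_fst] at h2
  rw [TangentBundle.continuousLinearMapAt_trivializationAt h]
  exact (DFunLike.congr_fun h2 u).symm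

theorem liouvilleForm_eq {α₀ α : CotangentBundle I M} (h : α.1 ∈ (chartAt H α₀.1).source) :
    liouvilleForm I M α = DiffForm.pullFrom J (extChartAt J α₀) (modelLiouville E) α := by
  ext v
  rw [DiffForm.pullFrom_apply, modelLiouville_apply, extChartAt_cotangent_apply,
    mfderiv_extChartAt_cotangent_fst h, ContinuousLinearMap.comp_apply,
    Trivialization.symmL_continuousLinearMapAt _ h]
  rfl

/-- The canonical symplectic form of `E × E^*`. -/
def modelCanonical (E : Type*) [NormedAddCommGroup E] [NormedSpace ℝ E] :
    (E × (E →L[ℝ] ℝ)) [⋀^Fin 2]→L[ℝ] ℝ :=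
  -extDeriv (modelLiouville E) 0

theorem modelCanonical_apply (v : Fin 2 → E × (E →L[ℝ] ℝ)) :
    modelCanonical E v = (v 1).2 (v 0).1 - (v 0).2 (v 1).1 := by
  rw [modelCanonical, ContinuousAlternatingMap.neg_apply, extDeriv_modelLiouville, neg_sub]

variable [I.Boundaryless]

theorem d_liouvilleForm_eq {α₀ α : CotangentBundle I M} (h : α.1 ∈ (chartAt H α₀.1).source) :
    (liouvilleForm I M).d α =
      DiffForm.pullFrom J (extChartAt J α₀) (extDeriv (modelLiouville E)) α := by
  have hd : Differentiable ℝ (modelLiouville E) := by fun_prop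
  refine DiffForm.d_pullFrom ?_ (hd _) ?_
  · exact contMDiffAt_extChartAt' (mem_chartAt_cotangent_source.2 h)
  · filter_upwards [(chartAt (ModelProd H (E →L[ℝ] ℝ)) α₀).open_source.mem_nhds
      (mem_chartAt_cotangent_source.2 h)] with β hβ
    exact liouvilleForm_eq (mem_chartAt_cotangent_source.1 hβ)

theorem canonicalForm_eq {α₀ α : CotangentBundle I M} (h : α.1 ∈ (chartAt H α₀.1).source) :
    canonicalForm I M α =
      DiffForm.pullFrom J (extChartAt J α₀) (fun _ => modelCanonical E) α := by
  rw [canonicalForm, d_liouvilleForm_eq h]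
  ext v
  rw [DiffForm.pullFrom_apply, modelCanonical_apply, ContinuousAlternatingMap.neg_apply,
    DiffForm.pullFrom_apply, extDeriv_modelLiouville, neg_sub]

/-- A map that changes the Liouville form by an exact form preserves the canonical form. -/
theorem pullback_canonicalForm {f : CotangentBundle I M → CotangentBundle I M}
    (hf : ContMDiff J J ∞ f) {h : CotangentBundle I M → ℝ} (hh : ContMDiff J 𝓘(ℝ, ℝ) ∞ h)
    (hfh : ∀ (α : CotangentBundle I M) (u : TangentSpace J α),
      liouvilleForm I M α ![u] =
        (liouvilleForm I M).pullback f α ![u] + DiffForm.differential J h α u) :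
    (canonicalForm I M).pullback f = canonicalForm I M := by
  funext α
  let c : ((E × (E →L[ℝ] ℝ)) × ℝ) [⋀^Fin 1]→L[ℝ] ℝ :=
    ContinuousAlternatingMap.ofSubsingleton ℝ _ ℝ (0 : Fin 1) (ContinuousLinearMap.snd ℝ _ ℝ)
  let A : (E × (E →L[ℝ] ℝ)) × ℝ → ((E × (E →L[ℝ] ℝ)) × ℝ) [⋀^Fin 1]→L[ℝ] ℝ := fun y =>
    (modelLiouville E y.1).compContinuousLinearMap (fderiv ℝ Prod.fst y)
  have hd : Differentiable ℝ (modelLiouville E) := by fun_prop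
  let L : ((E × (E →L[ℝ] ℝ)) × ℝ) →L[ℝ] (((E × (E →L[ℝ] ℝ)) × ℝ) [⋀^Fin 1]→L[ℝ] ℝ) :=
    (ContinuousAlternatingMap.compContinuousLinearMapCLM
      (ContinuousLinearMap.fst ℝ (E × (E →L[ℝ] ℝ)) ℝ)).comp
      ((modelLiouville E).comp (ContinuousLinearMap.fst ℝ (E × (E →L[ℝ] ℝ)) ℝ))
  have hAL : ∀ y, A y = L y := fun y => by
    simp only [A, fderiv_fst]
    rfl
  have hA : Differentiable ℝ A := by
    rw [funext hAL]
    fun_prop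
  have hext : ∀ y, extDeriv (fun y => A y + c) y =
      (extDeriv (modelLiouville E) y.1).compContinuousLinearMap (ContinuousLinearMap.fst ℝ _ ℝ) := by
    intro y
    rw [extDeriv_fun_add (hA y) (differentiableAt_const c), extDeriv_fun_const, add_zero,
      extDeriv_pullback (f := Prod.fst) (r := ∞) (hd _) contDiffAt_fst
        (by simpa using WithTop.coe_le_coe.2 (le_top : (2 : ℕ∞) ≤ ⊤)), fderiv_fst]
  have hfα : ContMDiffAt J 𝓘(ℝ, E × (E →L[ℝ] ℝ)) ∞ (extChartAt J (f α) ∘ f) α :=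
    contMDiffAt_extChartAt.comp α (hf α)
  have hg : ContMDiffAt J 𝓘(ℝ, (E × (E →L[ℝ] ℝ)) × ℝ) ∞
      (fun β => ((extChartAt J (f α) ∘ f) β, h β)) α := hfα.prodMk_space (hh α)
  have hdiff : ∀ β, MDifferentiableAt J 𝓘(ℝ, E × (E →L[ℝ] ℝ)) (extChartAt J (f α) ∘ f) β →
      ∀ u, DiffForm.differential J (fun β => ((extChartAt J (f α) ∘ f) β, h β)) β u =
        (DiffForm.differential J (extChartAt J (f α) ∘ f) β u, DiffForm.differential J h β u) := by
    intro β hβ u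
    have hhβ := ((hh β).mdifferentiableAt (by simp)).hasMFDerivAt
    have h1 : HasMFDerivAt J 𝓘(ℝ, (E × (E →L[ℝ] ℝ)) × ℝ)
        (fun β => ((extChartAt J (f α) ∘ f) β, h β)) β
        ((DiffForm.differential J (extChartAt J (f α) ∘ f) β).prod
          (DiffForm.differential J h β)) :=
      ⟨hβ.hasMFDerivAt.1.prodMk hhβ.1, hβ.hasMFDerivAt.2.prodMk hhβ.2⟩
    exact DFunLike.congr_fun h1.mfderiv u
  have hs : ∀ β, (f β).1 ∈ (chartAt H (f α).1).source →
      MDifferentiableAt J 𝓘(ℝ, E × (E →L[ℝ] ℝ)) (extChartAt J (f α)) (f β) := fun β hβ =>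
    mdifferentiableAt_extChartAt (mem_chartAt_cotangent_source.2 hβ)
  have hfm : ∀ β, MDifferentiableAt J J f β := fun β => (hf β).mdifferentiableAt (by simp)
  have key : (liouvilleForm I M).d α = DiffForm.pullFrom J
      (fun β => ((extChartAt J (f α) ∘ f) β, h β)) (extDeriv fun y => A y + c) α := by
    refine DiffForm.d_pullFrom hg (DifferentiableAt.fun_add (𝕜 := ℝ) (E := (E × (E →L[ℝ] ℝ)) × ℝ)
      (F := ((E × (E →L[ℝ] ℝ)) × ℝ) [⋀^Fin 1]→L[ℝ] ℝ) (hA _) (differentiableAt_const c)) ?_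
    filter_upwards [hf.continuous.continuousAt.preimage_mem_nhds
      ((chartAt (ModelProd H (E →L[ℝ] ℝ)) (f α)).open_source.mem_nhds
      (mem_chart_source _ (f α)))] with β hβ
    have hβ' := mem_chartAt_cotangent_source.1 hβ
    ext v
    have hv : v = ![v 0] := by ext i; fin_cases i; rfl
    rw [hv, hfh, DiffForm.pullback_pullFrom (liouvilleForm_eq hβ') (hs β hβ') (hfm β),
      DiffForm.pullFrom_apply, DiffForm.pullFrom_apply, ContinuousAlternatingMap.add_apply]
    simp only [hdiff β ((hs β hβ').comp β (hfm β)), A, fderiv_fst]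
    rfl
  have h1 : (liouvilleForm I M).d (f α) = _ := d_liouvilleForm_eq (mem_chart_source H (f α).1)
  have h2 := DiffForm.pullback_pullFrom (f := f) h1 (hs α (mem_chart_source H (f α).1)) (hfm α)
  have h3 : (liouvilleForm I M).d.pullback f α = (liouvilleForm I M).d α := by
    rw [h2, key]
    ext v
    rw [DiffForm.pullFrom_apply, DiffForm.pullFrom_apply, hext]
    simp only [hdiff α (hfα.mdifferentiableAt (by simp))]
    rfl
  rw [canonicalForm, ← h3]
  rfl

theorem isSymplecticForm_canonicalForm : IsSymplecticForm (canonicalForm I M) where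
  smooth α₀ := by
    refine contDiffOn_const (c := modelCanonical E) |>.congr fun z hz => ?_
    exact DiffForm.inChart_of_pullFrom_extChartAt
      (fun α hα => canonicalForm_eq (mem_chartAt_cotangent_source.1 hα)) hz
  closed α := by
    rw [DiffForm.d_pullFrom (g := extChartAt J α) (β := fun _ => modelCanonical E)
      contMDiffAt_extChartAt (differentiableAt_const _)]
    · ext v
      rw [DiffForm.pullFrom_apply, extDeriv_fun_const]
      rfl
    · filter_upwards [(chartAt (ModelProd H (E →L[ℝ] ℝ)) α).open_source.mem_nhds
        (mem_chart_source _ α)] with β hβ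
      exact canonicalForm_eq (mem_chartAt_cotangent_source.1 hβ)
  nondegenerate α u h := by
    have key : ∀ v : E × (E →L[ℝ] ℝ), modelCanonical E ![u, v] = 0 := by
      intro v
      have h1 := h v
      rw [canonicalForm_eq (mem_chart_source H α.1), DiffForm.pullFrom, DiffForm.differential,
        mfderiv_extChartAt_self] at h1
      exact h1
    replace key : ∀ v : E × (E →L[ℝ] ℝ), v.2 (Prod.fst u) - Prod.snd u v.1 = 0 := fun v => by
      rw [← key v, modelCanonical_apply]
      rfl
    refine Prod.ext ?_ ?_
    · refine SeparatingDual.eq_zero_of_forall_dual_eq_zero (R := ℝ) fun f => ?_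
      simpa using key (0, f)
    · ext e
      have := key (e, 0)
      simp only [zero_apply, zero_sub, neg_eq_zero] at this
      exact this

end Liouville

namespace FibrationOverReal

variable {E : Type*} [NormedAddCommGroup E] [NormedSpace ℝ E] {H : Type*} [TopologicalSpace H]
  {I : ModelWithCorners ℝ E H} {M : Type*} [TopologicalSpace M] [ChartedSpace H M]
  (p : FibrationOverReal I M) [FiniteDimensional ℝ E] [IsManifold I ∞ M]

local notation "J" => ModelWithCorners.prod I 𝓘(ℝ, E →L[ℝ] ℝ)
local notation "JV" => ModelWithCorners.prod I 𝓘(ℝ, VerticalModel E →L[ℝ] ℝ)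

omit [FiniteDimensional ℝ E] in
theorem psi_comp_symmL (x₀ : M) (s : ℝ) (α : CotangentBundle I M) :
    ((p.psi s α).2.comp ((trivializationAt E (TangentSpace I) x₀).symmL ℝ α.1) : E →L[ℝ] ℝ) =
      α.2.comp ((trivializationAt E (TangentSpace I) x₀).symmL ℝ α.1) + s • p.dtCoord x₀ α.1 := by
  ext v
  rfl

theorem contMDiff_psi :
    ContMDiff (𝓘(ℝ, ℝ).prod J) J ∞ (fun q : ℝ × CotangentBundle I M => p.psi q.1 q.2) := by
  rintro ⟨s, α⟩
  have hα : α.1 ∈ (trivializationAt E (TangentSpace I) α.1).baseSet := mem_chart_source H α.1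
  have hsnd : ContMDiffAt (𝓘(ℝ, ℝ).prod J) J ∞ (fun q : ℝ × CotangentBundle I M => q.2) (s, α) :=
    contMDiffAt_snd
  rw [contMDiffAt_dual_iff (E₁ := TangentSpace I) (x₀ := α.1) hα] at hsnd
  rw [contMDiffAt_dual_iff (E₁ := TangentSpace I) (x₀ := α.1) hα]
  refine ⟨hsnd.1, ?_⟩
  have hd : ContMDiffAt (𝓘(ℝ, ℝ).prod J) 𝓘(ℝ, E →L[ℝ] ℝ) ∞
      (fun q : ℝ × CotangentBundle I M => p.dtCoord α.1 q.2.1) (s, α) :=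
    ContMDiffAt.comp (s, α) ((p.contMDiffOn_dtCoord α.1).contMDiffAt
      ((trivializationAt E (TangentSpace I) α.1).open_baseSet.mem_nhds hα)) hsnd.1
  exact (hsnd.2.add (contMDiffAt_fst.smul hd)).congr_of_eventuallyEq
      (Filter.Eventually.of_forall fun q => p.psi_comp_symmL α.1 q.1 q.2)

theorem incl_symmL {x₀ x : M} (hx : x ∈ (p.verticalPretrivialization x₀).baseSet)
    (f : VerticalModel E) :
    p.incl x ((trivializationAt (VerticalModel E) p.VerticalSpace x₀).symmL ℝ x f) =
      (trivializationAt E (TangentSpace I) x₀).symmL ℝ x (p.verticalLift x₀ x f) := by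
  have h : (trivializationAt (VerticalModel E) p.VerticalSpace x₀).symmL ℝ x f =
      (⟨(trivializationAt E (TangentSpace I) x₀).symmL ℝ x
        (p.verticalLift x₀ x f), p.dtCoord_verticalLift x₀ x f⟩ : p.VerticalSpace x) := by
    rw [Trivialization.symmL_apply _ (by exact hx)]
    have h1 := (trivializationAt (VerticalModel E) p.VerticalSpace x₀).mk_symm (b := x) hx f
    have h2 : (trivializationAt (VerticalModel E) p.VerticalSpace
        x₀).toOpenPartialHomeomorph.symm (x, f) =
      ⟨x, ⟨(trivializationAt E (TangentSpace I) x₀).symmL ℝ x (p.verticalLift x₀ x f), p.dtCoord_verticalLift x₀ x f⟩⟩ := rfl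
    rw [h2] at h1
    exact TotalSpace.mk_inj.1 h1
  rw [h]
  rfl

theorem mu_comp_symmL {x₀ : M} {α : CotangentBundle I M}
    (hx : α.1 ∈ (p.verticalPretrivialization x₀).baseSet) :
    ((p.mu α).2.comp ((trivializationAt (VerticalModel E) p.VerticalSpace x₀).symmL ℝ α.1) :
        VerticalModel E →L[ℝ] ℝ) =
      (α.2.comp ((trivializationAt E (TangentSpace I) x₀).symmL ℝ α.1)).comp
        (p.verticalLift x₀ α.1) := by
  ext f
  exact congrArg α.2 (p.incl_symmL hx f)

theorem mem_verticalPretrivialization_baseSet (x₀ : M) :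
    x₀ ∈ (p.verticalPretrivialization x₀).baseSet :=
  FiberBundle.mem_baseSet_trivializationAt' (F := VerticalModel E) (E := p.VerticalSpace) x₀

theorem contMDiff_mu : ContMDiff J JV ∞ p.mu := by
  intro α
  have hV := p.mem_verticalPretrivialization_baseSet α.1
  have hid : ContMDiffAt J J ∞ (fun β : CotangentBundle I M => β) α := contMDiffAt_id
  rw [contMDiffAt_dual_iff (E₁ := TangentSpace I) (x₀ := α.1) (by exact hV.1)] at hid
  rw [contMDiffAt_dual_iff (E₁ := p.VerticalSpace) (x₀ := α.1) (by exact hV)]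
  refine ⟨hid.1, ?_⟩
  have hop := (p.verticalPretrivialization α.1).open_baseSet.mem_nhds hV
  have hl : ContMDiffAt J 𝓘(ℝ, VerticalModel E →L[ℝ] E) ∞
      (fun β : CotangentBundle I M => p.verticalLift α.1 β.1) α :=
    ContMDiffAt.comp α ((p.contMDiffOn_verticalLift α.1).contMDiffAt hop) hid.1
  refine (hid.2.clm_comp hl).congr_of_eventuallyEq ?_
  filter_upwards [hid.1.continuousAt.preimage_mem_nhds hop] with β hβ
  exact p.mu_comp_symmL hβ

/-- The second component of the splitting of `E` at `x₀`. -/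
def splittingSnd (x₀ : M) : E →L[ℝ] VerticalModel E :=
  (ContinuousLinearMap.snd ℝ ℝ (VerticalModel E)).comp
    (p.splitting x₀ : E →L[ℝ] ℝ × VerticalModel E)

/-- The chosen transversal direction `∂_t`. -/
def transvDir (x₀ : M) : E := (p.splitting x₀).symm (1, 0)

theorem splittingSnd_transvDir (x₀ : M) : p.splittingSnd x₀ (p.transvDir x₀) = 0 := by
  simp [splittingSnd, transvDir]

theorem verticalLift_splittingSnd {x₀ x : M} (hx : p.transv x₀ x ≠ 0) (u : E) :
    p.verticalLift x₀ x (p.splittingSnd x₀ u) =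
      u - (p.dtCoord x₀ x u / p.transv x₀ x) • p.transvDir x₀ := by
  have h1 := p.verticalLift_splitting hx
    (u - (p.dtCoord x₀ x u / p.transv x₀ x) • p.transvDir x₀) (by
      rw [map_sub, map_smul, smul_eq_mul, transvDir]
      change _ - _ * p.transv x₀ x = 0
      field_simp
      ring)
  rw [← h1]
  congr 1
  change _ = p.splittingSnd x₀ _
  rw [map_sub, map_smul, splittingSnd_transvDir, smul_zero, sub_zero]

/-- The fibre coordinate of `μ_π` around `x₀`: the momentum along `∂_t`, normalized. -/
def fiberCoord (x₀ : M) (α : CotangentBundle I M) : ℝ :=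
  (p.transv x₀ α.1)⁻¹ *
    α.2 ((trivializationAt E (TangentSpace I) x₀).symmL ℝ α.1 (p.transvDir x₀))

/-- The covector, in coordinates around `x₀`, with given restriction to `Vπ` and fibre coordinate. -/
def covectorCoord (x₀ : M) (ν : p.DualVerticalBundle) (s : ℝ) : E →L[ℝ] ℝ :=
  ((ν.2.comp ((trivializationAt (VerticalModel E) p.VerticalSpace x₀).symmL ℝ ν.1) :
    VerticalModel E →L[ℝ] ℝ)).comp (p.splittingSnd x₀) + s • p.dtCoord x₀ ν.1

/-- The local inverse of `(μ_π, fiberCoord)`. -/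
def covectorOfCoord (x₀ : M) (q : p.DualVerticalBundle × ℝ) : CotangentBundle I M :=
  ⟨q.1.1, (p.covectorCoord x₀ q.1 q.2).comp
    ((trivializationAt E (TangentSpace I) x₀).continuousLinearMapAt ℝ q.1.1)⟩

theorem fiberCoord_psi {x₀ : M} (s : ℝ) {α : CotangentBundle I M}
    (hx : α.1 ∈ (p.verticalPretrivialization x₀).baseSet) :
    p.fiberCoord x₀ (p.psi s α) = p.fiberCoord x₀ α + s := by
  have h : p.transv x₀ α.1 ≠ 0 := hx.2
  have h1 := DFunLike.congr_fun (p.psi_comp_symmL x₀ s α) (p.transvDir x₀)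
  have h2 : (p.psi s α).2 ((trivializationAt E (TangentSpace I) x₀).symmL ℝ α.1 (p.transvDir x₀)) =
    α.2 ((trivializationAt E (TangentSpace I) x₀).symmL ℝ α.1 (p.transvDir x₀)) +
      s * p.transv x₀ α.1 := h1
  refine (congrArg (fun t : ℝ => (p.transv x₀ α.1)⁻¹ * t) h2).trans ?_
  rw [fiberCoord]
  field_simp

omit [FiniteDimensional ℝ E] [IsManifold I ∞ M] in
theorem mu_psi (s : ℝ) (α : CotangentBundle I M) : p.mu (p.psi s α) = p.mu α := by
  refine congrArg (TotalSpace.mk α.1) ?_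
  refine ContinuousLinearMap.ext fun (w : p.VerticalSpace α.1) => ?_
  change α.2 (p.incl α.1 w) + s * p.dt α.1 (p.incl α.1 w) = α.2 (p.incl α.1 w)
  rw [dt_incl, mul_zero, add_zero]

theorem covectorOfCoord_comp_symmL {x₀ : M} {q : p.DualVerticalBundle × ℝ}
    (hx : q.1.1 ∈ (p.verticalPretrivialization x₀).baseSet) :
    ((p.covectorOfCoord x₀ q).2.comp ((trivializationAt E (TangentSpace I) x₀).symmL ℝ q.1.1) :
      E →L[ℝ] ℝ) = p.covectorCoord x₀ q.1 q.2 := by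
  ext v
  exact congrArg (p.covectorCoord x₀ q.1 q.2) (Trivialization.continuousLinearMapAt_symmL _ hx.1 v)

theorem covectorOfCoord_mu {x₀ : M} {α : CotangentBundle I M}
    (hx : α.1 ∈ (p.verticalPretrivialization x₀).baseSet) :
    p.covectorOfCoord x₀ (p.mu α, p.fiberCoord x₀ α) = α := by
  refine congrArg (TotalSpace.mk α.1) ?_
  refine ContinuousLinearMap.ext fun (u : TangentSpace I α.1) => ?_
  change p.covectorCoord x₀ (p.mu α) (p.fiberCoord x₀ α)
    ((trivializationAt E (TangentSpace I) x₀).continuousLinearMapAt ℝ α.1 u) = α.2 u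
  rw [covectorCoord]
  erw [p.mu_comp_symmL hx]
  have h2 := p.verticalLift_splittingSnd hx.2
    ((trivializationAt E (TangentSpace I) x₀).continuousLinearMapAt ℝ α.1 u)
  simp only [add_apply, ContinuousLinearMap.comp_apply,
    smul_apply, fiberCoord]
  erw [h2]
  rw [map_sub, map_smul, map_sub, map_smul, Trivialization.symmL_continuousLinearMapAt _ hx.1]
  simp only [smul_eq_mul]
  change _ + _ * p.dtCoord x₀ α.1 _ = _
  ring

theorem mu_covectorOfCoord {x₀ : M} {q : p.DualVerticalBundle × ℝ}
    (hx : q.1.1 ∈ (p.verticalPretrivialization x₀).baseSet) :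
    p.mu (p.covectorOfCoord x₀ q) = q.1 := by
  obtain ⟨⟨x, ν⟩, s⟩ := q
  refine congrArg (TotalSpace.mk x) ?_
  ext w
  set u : E := (trivializationAt E (TangentSpace I) x₀).continuousLinearMapAt ℝ x (p.incl x w)
    with hu
  have hdt : p.dtCoord x₀ x u = 0 := (p.dtCoord_apply_coord hx.1 _).trans (p.dt_incl x w)
  have hw : (trivializationAt (VerticalModel E) p.VerticalSpace x₀).symmL ℝ x
      (p.splittingSnd x₀ u) = w := by
    apply p.incl_injective x
    rw [p.incl_symmL hx, p.verticalLift_splittingSnd hx.2, hdt, zero_div, zero_smul, sub_zero, hu,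
      Trivialization.symmL_continuousLinearMapAt _ hx.1]
  change ν ((trivializationAt (VerticalModel E) p.VerticalSpace x₀).symmL ℝ x
      (p.splittingSnd x₀ u)) + s * p.dtCoord x₀ x u = ν w
  rw [hw, hdt, mul_zero, add_zero]

theorem fiberCoord_covectorOfCoord {x₀ : M} {q : p.DualVerticalBundle × ℝ}
    (hx : q.1.1 ∈ (p.verticalPretrivialization x₀).baseSet) :
    p.fiberCoord x₀ (p.covectorOfCoord x₀ q) = q.2 := by
  have h : p.transv x₀ q.1.1 ≠ 0 := hx.2
  have h1 := DFunLike.congr_fun (p.covectorOfCoord_comp_symmL hx) (p.transvDir x₀)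
  change (p.transv x₀ q.1.1)⁻¹ * _ = _
  erw [h1]
  have h2 : p.dtCoord x₀ q.1.1 (p.transvDir x₀) = p.transv x₀ q.1.1 := rfl
  simp only [covectorCoord, add_apply, ContinuousLinearMap.comp_apply,
    smul_apply, splittingSnd_transvDir, map_zero, zero_add, h2, smul_eq_mul]
  field_simp

theorem contMDiffOn_fiberCoord (x₀ : M) :
    ContMDiffOn J 𝓘(ℝ, ℝ) ∞ (p.fiberCoord x₀)
      (TotalSpace.proj ⁻¹' (p.verticalPretrivialization x₀).baseSet) := by
  intro α hα
  apply ContMDiffAt.contMDiffWithinAt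
  have hid : ContMDiffAt J J ∞ (fun β : CotangentBundle I M => β) α := contMDiffAt_id
  rw [contMDiffAt_dual_iff (E₁ := TangentSpace I) (x₀ := x₀) (by exact hα.1)] at hid
  have hd : ContMDiffAt J 𝓘(ℝ, E →L[ℝ] ℝ) ∞
      (fun β : CotangentBundle I M => p.dtCoord x₀ β.1) α :=
    ContMDiffAt.comp α ((p.contMDiffOn_dtCoord x₀).contMDiffAt
      ((trivializationAt E (TangentSpace I) x₀).open_baseSet.mem_nhds hα.1)) hid.1
  have ht : ContMDiffAt J 𝓘(ℝ, ℝ) ∞ (fun β : CotangentBundle I M => p.transv x₀ β.1) α :=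
    hd.clm_apply contMDiffAt_const
  exact (ht.inv₀ hα.2).mul (hid.2.clm_apply (contMDiffAt_const (c := p.transvDir x₀)))

theorem contMDiffOn_covectorOfCoord (x₀ : M) :
    ContMDiffOn (ModelWithCorners.prod JV 𝓘(ℝ, ℝ)) J ∞ (p.covectorOfCoord x₀)
      ((TotalSpace.proj ⁻¹' (p.verticalPretrivialization x₀).baseSet) ×ˢ univ) := by
  rintro q ⟨hq, -⟩
  apply ContMDiffAt.contMDiffWithinAt
  have hq' : q.1.1 ∈ (p.verticalPretrivialization x₀).baseSet := hq
  have hfst : ContMDiffAt (ModelWithCorners.prod JV 𝓘(ℝ, ℝ)) JV ∞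
    (fun q : p.DualVerticalBundle × ℝ => q.1) q := contMDiffAt_fst
  rw [contMDiffAt_dual_iff (E₁ := p.VerticalSpace) (x₀ := x₀) (by exact hq')] at hfst
  rw [contMDiffAt_dual_iff (E₁ := TangentSpace I) (x₀ := x₀) (by exact hq'.1)]
  refine ⟨hfst.1, ?_⟩
  have hd : ContMDiffAt (ModelWithCorners.prod JV 𝓘(ℝ, ℝ)) 𝓘(ℝ, E →L[ℝ] ℝ) ∞
      (fun r : p.DualVerticalBundle × ℝ => p.dtCoord x₀ r.1.1) q :=
    ContMDiffAt.comp q ((p.contMDiffOn_dtCoord x₀).contMDiffAt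
      ((trivializationAt E (TangentSpace I) x₀).open_baseSet.mem_nhds hq'.1)) hfst.1
  refine ((hfst.2.clm_comp (contMDiffAt_const (c := p.splittingSnd x₀))).add
    (contMDiffAt_snd.smul hd)).congr_of_eventuallyEq ?_
  filter_upwards [hfst.1.continuousAt.preimage_mem_nhds
    ((p.verticalPretrivialization x₀).open_baseSet.mem_nhds hq')] with r hr
  exact p.covectorOfCoord_comp_symmL hr

/-- The local trivialization of `μ_π` around `x₀`. -/
def muTrivialization (x₀ : M) : Trivialization ℝ p.mu where
  toFun α := (p.mu α, p.fiberCoord x₀ α)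
  invFun := p.covectorOfCoord x₀
  source := TotalSpace.proj ⁻¹' (p.verticalPretrivialization x₀).baseSet
  target := (TotalSpace.proj ⁻¹' (p.verticalPretrivialization x₀).baseSet) ×ˢ univ
  map_source' _ h := ⟨h, mem_univ _⟩
  map_target' _ h := h.1
  left_inv' _ h := p.covectorOfCoord_mu h
  right_inv' _ h := Prod.ext (p.mu_covectorOfCoord h.1) (p.fiberCoord_covectorOfCoord h.1)
  open_source := (p.verticalPretrivialization x₀).open_baseSet.preimage
    (FiberBundle.continuous_proj _ _)
  open_target := ((p.verticalPretrivialization x₀).open_baseSet.preimage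
    (FiberBundle.continuous_proj _ _)).prod isOpen_univ
  continuousOn_toFun := p.contMDiff_mu.continuous.continuousOn.prodMk
    (p.contMDiffOn_fiberCoord x₀).continuousOn
  continuousOn_invFun := (p.contMDiffOn_covectorOfCoord x₀).continuousOn
  baseSet := TotalSpace.proj ⁻¹' (p.verticalPretrivialization x₀).baseSet
  open_baseSet := (p.verticalPretrivialization x₀).open_baseSet.preimage
    (FiberBundle.continuous_proj _ _)
  source_eq := rfl
  target_eq := rfl
  proj_toFun _ _ := rfl

theorem isPrincipalRBundle_mu : IsPrincipalRBundle J JV p.mu p.psi where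
  contMDiff_proj := p.contMDiff_mu
  zero_act α := by
    refine congrArg (TotalSpace.mk α.1) ?_
    rw [zero_smul, add_zero]
  add_act s t α := by
    refine congrArg (TotalSpace.mk α.1) ?_
    change α.2 + (s + t) • p.dt α.1 = α.2 + t • p.dt α.1 + s • p.dt α.1
    rw [add_smul, add_assoc, add_comm (t • p.dt α.1)]
  contMDiff_act := p.contMDiff_psi
  proj_act := p.mu_psi
  locallyTrivial ν :=
    ⟨p.muTrivialization ν.1, p.mem_verticalPretrivialization_baseSet ν.1,
      p.contMDiff_mu.contMDiffOn.prodMk (p.contMDiffOn_fiberCoord ν.1),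
      p.contMDiffOn_covectorOfCoord ν.1,
      fun s α hα => Prod.ext (p.mu_psi s α) (p.fiberCoord_psi s hα)⟩

theorem contMDiff_psi_apply (s : ℝ) : ContMDiff J J ∞ (p.psi s) :=
  p.contMDiff_psi.comp (contMDiff_const.prodMk contMDiff_id)

variable [I.Boundaryless]

theorem pullback_psi_canonicalForm (s : ℝ) :
    (canonicalForm I M).pullback (p.psi s) = canonicalForm I M := by
  have hproj : ContMDiff J I ∞ (TotalSpace.proj : CotangentBundle I M → M) :=
    Bundle.contMDiff_proj _
  have hc : ContMDiff J 𝓘(ℝ, ℝ) ∞ (fun α : CotangentBundle I M => p.toFun α.1) :=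
    p.contMDiff.comp hproj
  have hh : ContMDiff J 𝓘(ℝ, ℝ) ∞ (fun α : CotangentBundle I M => (-s) • p.toFun α.1) :=
    (contDiff_const_smul (-s)).contMDiff.comp hc
  refine pullback_canonicalForm (p.contMDiff_psi_apply s) hh fun α u => ?_
  have hpm : MDifferentiableAt J I (TotalSpace.proj : CotangentBundle I M → M) α :=
    (hproj α).mdifferentiableAt (by simp)
  have h1 : DiffForm.differential J (fun α : CotangentBundle I M => (-s) • p.toFun α.1) α u =
      (-s) * p.dt α.1 (mfderiv J I TotalSpace.proj α u) := by
    have h2 : HasMFDerivAt J 𝓘(ℝ, ℝ) (fun α : CotangentBundle I M => (-s) • p.toFun α.1) α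
        ((-s) • (mfderiv J 𝓘(ℝ, ℝ) (fun α : CotangentBundle I M => p.toFun α.1) α)) :=
      ((hc α).mdifferentiableAt (by simp)).hasMFDerivAt.const_smul (-s)
    have h3 := mfderiv_comp_apply α ((p.contMDiff α.1).mdifferentiableAt (by simp)) hpm u
    rw [DiffForm.differential, h2.mfderiv]
    exact congrArg (fun t : ℝ => (-s) * t) h3
  have h4 : mfderiv J I (TotalSpace.proj : CotangentBundle I M → M) (p.psi s α)
      (mfderiv J J (p.psi s) α u) = mfderiv J I TotalSpace.proj α u :=
    (mfderiv_comp_apply α ((hproj _).mdifferentiableAt (by simp))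
      ((p.contMDiff_psi_apply s α).mdifferentiableAt (by simp)) u).symm
  rw [h1]
  change α.2 (mfderiv J I TotalSpace.proj α u) =
    (p.psi s α).2 (mfderiv J I (TotalSpace.proj : CotangentBundle I M → M) (p.psi s α)
      (mfderiv J J (p.psi s) α u)) + _
  rw [h4]
  change _ = (α.2 (mfderiv J I TotalSpace.proj α u) + s * p.dt α.1 _) + _
  ring

theorem isSymplecticPrincipalRBundle_mu :
    IsSymplecticPrincipalRBundle J JV p.mu p.psi (canonicalForm I M) where
  principal := p.isPrincipalRBundle_mu
  symplectic := isSymplecticForm_canonicalForm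
  act_symplectic := p.pullback_psi_canonicalForm

end FibrationOverReal

section Lift

variable {E : Type*} [NormedAddCommGroup E] [NormedSpace ℝ E] {H : Type*} [TopologicalSpace H]
  {I : ModelWithCorners ℝ E H} {M : Type*} [TopologicalSpace M] [ChartedSpace H M]
  {EG : Type*} [NormedAddCommGroup EG] [NormedSpace ℝ EG]
  {HG : Type*} [TopologicalSpace HG] {IG : ModelWithCorners ℝ EG HG}
  {G : Type*} [Group G] [TopologicalSpace G] [ChartedSpace HG G]
  {φ : G → M → M}

local notation "J" => ModelWithCorners.prod I 𝓘(ℝ, E →L[ℝ] ℝ)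

namespace IsLieGroupAction

theorem contMDiff_apply (hφ : IsLieGroupAction I IG φ) (g : G) : ContMDiff I I ∞ (φ g) :=
  hφ.contMDiff.comp (contMDiff_const.prodMk contMDiff_id)

theorem mdifferentiableAt (hφ : IsLieGroupAction I IG φ) (g : G) (x : M) :
    MDifferentiableAt I I (φ g) x :=
  (hφ.contMDiff_apply g x).mdifferentiableAt (by simp)

theorem one_eq (hφ : IsLieGroupAction I IG φ) : φ 1 = id := funext hφ.one_act

theorem mul_eq (hφ : IsLieGroupAction I IG φ) (g h : G) : φ (g * h) = φ g ∘ φ h :=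
  funext (hφ.mul_act g h)

theorem inv_act_act (hφ : IsLieGroupAction I IG φ) (g : G) (x : M) : φ g⁻¹ (φ g x) = x := by
  rw [← hφ.mul_act, inv_mul_cancel, hφ.one_act]

theorem act_inv_act (hφ : IsLieGroupAction I IG φ) (g : G) (x : M) : φ g (φ g⁻¹ x) = x := by
  rw [← hφ.mul_act, mul_inv_cancel, hφ.one_act]

theorem mfderiv_inv_mfderiv (hφ : IsLieGroupAction I IG φ) (g : G) (x : M)
    (u : TangentSpace I x) :
    (mfderiv I I (φ g⁻¹) (φ g x) (mfderiv I I (φ g) x u) : E) = u := by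
  have h1 := mfderiv_comp_apply x (hφ.mdifferentiableAt g⁻¹ (φ g x)) (hφ.mdifferentiableAt g x) u
  have h2 : φ g⁻¹ ∘ φ g = id := funext (hφ.inv_act_act g)
  rw [h2, mfderiv_id] at h1
  exact h1.symm

theorem mfderiv_mfderiv_inv (hφ : IsLieGroupAction I IG φ) (g : G) (x : M)
    (u : TangentSpace I (φ g x)) :
    (mfderiv I I (φ g) x (mfderiv I I (φ g⁻¹) (φ g x) u : E) : E) = u := by
  have h1 := mfderiv_comp_apply_of_eq (x := φ g x) (hφ.mdifferentiableAt g x)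
    (hφ.mdifferentiableAt g⁻¹ (φ g x)) (hφ.inv_act_act g x) u
  have h2 : φ g ∘ φ g⁻¹ = id := funext (hφ.act_inv_act g)
  rw [h2, mfderiv_id] at h1
  exact h1.symm

/-- The differential of an action at a point, as an isomorphism. -/
def mfderivEquiv (hφ : IsLieGroupAction I IG φ) (g : G) (x : M) :
    TangentSpace I x ≃L[ℝ] TangentSpace I (φ g x) :=
  ContinuousLinearEquiv.equivOfInverse (mfderiv I I (φ g) x)
    (mfderiv I I (φ g⁻¹) (φ g x) : E →L[ℝ] E) (hφ.mfderiv_inv_mfderiv g x)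
    (hφ.mfderiv_mfderiv_inv g x)

theorem inverse_mfderiv (hφ : IsLieGroupAction I IG φ) (g : G) (x : M) :
    (mfderiv I I (φ g) x).inverse = ((hφ.mfderivEquiv g x).symm : _ →L[ℝ] _) :=
  ContinuousLinearMap.inverse_equiv (hφ.mfderivEquiv g x)

theorem cotangentLift_one (hφ : IsLieGroupAction I IG φ) (α : CotangentBundle I M) :
    cotangentLift I φ 1 α = α := by
  rw [cotangentLift, hφ.one_eq, mfderiv_id, ContinuousLinearMap.inverse_id]
  rfl

theorem cotangentLift_mul (hφ : IsLieGroupAction I IG φ) (g h : G) (α : CotangentBundle I M) :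
    cotangentLift I φ (g * h) α = cotangentLift I φ g (cotangentLift I φ h α) := by
  rw [cotangentLift, hφ.mul_eq, mfderiv_comp α.1 (hφ.mdifferentiableAt g (φ h α.1))
    (hφ.mdifferentiableAt h α.1)]
  refine congrArg (TotalSpace.mk (φ g (φ h α.1))) ?_
  have h1 : ((mfderiv I I (φ g) (φ h α.1)).comp (mfderiv I I (φ h) α.1)).inverse =
      (mfderiv I I (φ h) α.1).inverse.comp (mfderiv I I (φ g) (φ h α.1)).inverse := by
    rw [hφ.inverse_mfderiv, hφ.inverse_mfderiv]
    exact ContinuousLinearMap.inverse_equiv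
      ((hφ.mfderivEquiv h α.1).trans (hφ.mfderivEquiv g (φ h α.1)))
  refine (congrArg (fun T => α.2.comp T) h1).trans ?_
  rfl

variable [IsManifold I ∞ M]

theorem contMDiff_cotangentLift [LieGroup IG ∞ G] (hφ : IsLieGroupAction I IG φ) :
    ContMDiff (IG.prod J) J ∞ (fun q : G × CotangentBundle I M => cotangentLift I φ q.1 q.2) := by
  rintro ⟨g₀, α₀⟩
  have h0 : α₀.1 ∈ (trivializationAt E (TangentSpace I) α₀.1).baseSet := mem_chart_source H α₀.1
  have h1 : φ g₀ α₀.1 ∈ (trivializationAt E (TangentSpace I) (φ g₀ α₀.1)).baseSet :=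
    mem_chart_source H (φ g₀ α₀.1)
  have hfst : ContMDiffAt (IG.prod J) IG ∞ (fun q : G × CotangentBundle I M => q.1) (g₀, α₀) :=
    contMDiffAt_fst
  have hsnd : ContMDiffAt (IG.prod J) J ∞ (fun q : G × CotangentBundle I M => q.2) (g₀, α₀) :=
    contMDiffAt_snd
  rw [contMDiffAt_dual_iff (E₁ := TangentSpace I) (x₀ := α₀.1) h0] at hsnd
  rw [contMDiffAt_dual_iff (E₁ := TangentSpace I) (x₀ := φ g₀ α₀.1) h1]
  have hbase : ContMDiffAt (IG.prod J) I ∞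
      (fun q : G × CotangentBundle I M => φ q.1 q.2.1) (g₀, α₀) :=
    ContMDiffAt.comp (g₀, α₀) (hφ.contMDiff (g₀, α₀.1)) (hfst.prodMk hsnd.1)
  refine ⟨hbase, ?_⟩
  have hinv : ContMDiffAt ((IG.prod J).prod I) I ∞
      (Function.uncurry fun (q : G × CotangentBundle I M) (y : M) => φ q.1⁻¹ y)
      ((g₀, α₀), φ g₀ α₀.1) := by
    have h : ContMDiffAt ((IG.prod J).prod I) IG ∞
        (fun r : (G × CotangentBundle I M) × M => r.1.1⁻¹) ((g₀, α₀), φ g₀ α₀.1) :=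
      ContMDiffAt.inv contMDiffAt_fst.fst
    exact hφ.contMDiff.contMDiffAt.comp ((g₀, α₀), φ g₀ α₀.1) (h.prodMk contMDiffAt_snd)
  have hd := ContMDiffAt.mfderiv (fun (q : G × CotangentBundle I M) (y : M) => φ q.1⁻¹ y)
    (fun q : G × CotangentBundle I M => φ q.1 q.2.1) hinv hbase (m := ∞) (by simp)
  have hk : (fun q : G × CotangentBundle I M => φ q.1⁻¹ (φ q.1 q.2.1)) = fun q => q.2.1 :=
    funext fun q => hφ.inv_act_act q.1 q.2.1
  have hd' : ContMDiffAt (IG.prod J) 𝓘(ℝ, E →L[ℝ] E) ∞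
      (inTangentCoordinates I I (fun q : G × CotangentBundle I M => φ q.1 q.2.1) (fun q => q.2.1)
        (fun q => (mfderiv I I (φ q.1⁻¹) (φ q.1 q.2.1) : E →L[ℝ] E)) (g₀, α₀)) (g₀, α₀) := by
    have aux : ∀ k : G × CotangentBundle I M → M,
        (fun q : G × CotangentBundle I M => φ q.1⁻¹ (φ q.1 q.2.1)) = k →
        ContMDiffAt (IG.prod J) 𝓘(ℝ, E →L[ℝ] E) ∞
          (inTangentCoordinates I I (fun q : G × CotangentBundle I M => φ q.1 q.2.1) k
          (fun q => (mfderiv I I (φ q.1⁻¹) (φ q.1 q.2.1) : E →L[ℝ] E)) (g₀, α₀)) (g₀, α₀) := by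
      rintro k rfl
      exact hd
    exact aux _ hk
  refine (hsnd.2.clm_comp hd').congr_of_eventuallyEq ?_
  filter_upwards [hsnd.1.continuousAt.preimage_mem_nhds
    ((trivializationAt E (TangentSpace I) α₀.1).open_baseSet.mem_nhds h0)] with q hq
  ext v
  change q.2.2 ((mfderiv I I (φ q.1) q.2.1).inverse
      ((trivializationAt E (TangentSpace I) (φ g₀ α₀.1)).symmL ℝ (φ q.1 q.2.1) v)) =
    q.2.2 ((trivializationAt E (TangentSpace I) α₀.1).symmL ℝ q.2.1
      ((trivializationAt E (TangentSpace I) α₀.1).continuousLinearMapAt ℝ q.2.1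
        (mfderiv I I (φ q.1⁻¹) (φ q.1 q.2.1)
          ((trivializationAt E (TangentSpace I) (φ g₀ α₀.1)).symmL ℝ (φ q.1 q.2.1) v) : E)))
  rw [hφ.inverse_mfderiv]
  erw [Trivialization.symmL_continuousLinearMapAt _ hq]
  rfl

theorem isLieGroupAction_cotangentLift [LieGroup IG ∞ G] (hφ : IsLieGroupAction I IG φ) :
    IsLieGroupAction J IG (cotangentLift I φ) where
  one_act := hφ.cotangentLift_one
  mul_act := hφ.cotangentLift_mul
  contMDiff := hφ.contMDiff_cotangentLift

theorem pullback_cotangentLift_canonicalForm [LieGroup IG ∞ G] [I.Boundaryless]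
    (hφ : IsLieGroupAction I IG φ) (g : G) :
    (canonicalForm I M).pullback (cotangentLift I φ g) = canonicalForm I M := by
  have hlift := hφ.isLieGroupAction_cotangentLift
  refine pullback_canonicalForm (hlift.contMDiff_apply g) (h := fun _ => 0) contMDiff_const
    fun α u => ?_
  have hpm : ∀ β, MDifferentiableAt J I (TotalSpace.proj : CotangentBundle I M → M) β :=
    fun β => (Bundle.contMDiff_proj (n := ∞) _ β).mdifferentiableAt (by simp)
  have h1 := mfderiv_comp_apply α (hpm (cotangentLift I φ g α)) (hlift.mdifferentiableAt g α) u
  have h2 := mfderiv_comp_apply α (hφ.mdifferentiableAt g α.1) (hpm α) u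
  have h3 : (TotalSpace.proj : CotangentBundle I M → M) ∘ cotangentLift I φ g =
    φ g ∘ TotalSpace.proj := rfl
  rw [h3, h2] at h1
  have h4 : DiffForm.differential J (fun _ : CotangentBundle I M => (0 : ℝ)) α u = 0 := by
    rw [DiffForm.differential, mfderiv_const]
    rfl
  rw [h4, add_zero]
  change α.2 (mfderiv J I TotalSpace.proj α u) =
    α.2 ((mfderiv I I (φ g) α.1).inverse
      (mfderiv J I (TotalSpace.proj : CotangentBundle I M → M) (cotangentLift I φ g α)
        (mfderiv J J (cotangentLift I φ g) α u)))
  refine congrArg α.2 ?_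
  rw [hφ.inverse_mfderiv]
  exact ((congrArg (hφ.mfderivEquiv g α.1).symm h1.symm).trans
    ((hφ.mfderivEquiv g α.1).symm_apply_apply _)).symm

end IsLieGroupAction

end Lift

section Canonical

variable {E : Type*} [NormedAddCommGroup E] [NormedSpace ℝ E]
  {H : Type*} [TopologicalSpace H]
  {I : ModelWithCorners ℝ E H} {M : Type*} [TopologicalSpace M] [ChartedSpace H M]
  {EG : Type*} [NormedAddCommGroup EG] [NormedSpace ℝ EG]
  {HG : Type*} [TopologicalSpace HG] {IG : ModelWithCorners ℝ EG HG}
  {G : Type*} [Group G] [TopologicalSpace G] [ChartedSpace HG G]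
  {φ : G → M → M} (p : FibrationOverReal I M)

local notation "J" => ModelWithCorners.prod I 𝓘(ℝ, E →L[ℝ] ℝ)

namespace FibrationOverReal

theorem dt_comp_mfderiv (hφ : IsLieGroupAction I IG φ)
    (hinv : ∀ (g : G) (x : M), p.toFun (φ g x) = p.toFun x) (g : G) (x : M)
    (u : TangentSpace I x) : p.dt (φ g x) (mfderiv I I (φ g) x u) = p.dt x u := by
  have h1 := mfderiv_comp_apply x ((p.contMDiff (φ g x)).mdifferentiableAt (by simp))
    (hφ.mdifferentiableAt g x) u
  have h2 : p.toFun ∘ φ g = p.toFun := funext (hinv g)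
  rw [h2] at h1
  exact h1.symm

theorem cotangentLift_psi (hφ : IsLieGroupAction I IG φ)
    (hinv : ∀ (g : G) (x : M), p.toFun (φ g x) = p.toFun x) (g : G) (s : ℝ)
    (α : CotangentBundle I M) :
    cotangentLift I φ g (p.psi s α) = p.psi s (cotangentLift I φ g α) := by
  refine congrArg (TotalSpace.mk (φ g α.1)) ?_
  refine ContinuousLinearMap.ext fun (u : TangentSpace I (φ g α.1)) => ?_
  change α.2 _ + s * p.dt α.1 ((mfderiv I I (φ g) α.1).inverse u) = α.2 _ + s * p.dt (φ g α.1) u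
  have h : p.dt α.1 ((mfderiv I I (φ g) α.1).inverse u) = p.dt (φ g α.1) u := by
    rw [← p.dt_comp_mfderiv hφ hinv g, hφ.inverse_mfderiv]
    exact congrArg (p.dt (φ g α.1)) ((hφ.mfderivEquiv g α.1).apply_symm_apply u)
  rw [h]
  rfl

variable [FiniteDimensional ℝ E] [IsManifold I ∞ M]

theorem differential_extChartAt_realGenerator (α : CotangentBundle I M) :
    DiffForm.differential J (extChartAt J α) α (realGenerator J p.psi α) =
      (0, p.dtCoord α.1 α.1) := by
  have hz : p.psi 0 α = α := p.isPrincipalRBundle_mu.zero_act α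
  have hc : MDifferentiableAt 𝓘(ℝ, ℝ) J (fun s : ℝ => p.psi s α) 0 :=
    (p.contMDiff_psi.comp (contMDiff_id.prodMk contMDiff_const) 0).mdifferentiableAt
      (n := ∞) (by simp)
  have h1 := mfderiv_comp_apply_of_eq (x := (0 : ℝ)) (mdifferentiableAt_extChartAt (I := J)
    (mem_chart_source (ModelProd H (E →L[ℝ] ℝ)) α)) hc hz (1 : ℝ)
  have h2 : extChartAt J α ∘ (fun s : ℝ => p.psi s α) = fun s : ℝ =>
      (extChartAt I α.1 α.1, (α.2.comp ((trivializationAt E (TangentSpace I) α.1).symmL ℝ α.1) :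
        E →L[ℝ] ℝ) + s • p.dtCoord α.1 α.1) := by
    funext s
    rw [Function.comp_apply, extChartAt_cotangent_apply]
    exact congrArg (Prod.mk _) (p.psi_comp_symmL α.1 s α)
  have h3 : HasFDerivAt (fun s : ℝ =>
      (extChartAt I α.1 α.1, (α.2.comp ((trivializationAt E (TangentSpace I) α.1).symmL ℝ α.1) :
        E →L[ℝ] ℝ) + s • p.dtCoord α.1 α.1))
      ((0 : ℝ →L[ℝ] E).prod ((ContinuousLinearMap.id ℝ ℝ).smulRight (p.dtCoord α.1 α.1))) 0 :=
    (hasFDerivAt_const _ _).prodMk (((hasFDerivAt_id (0 : ℝ)).smul_const _).const_add _)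
  rw [h2, mfderiv_eq_fderiv, h3.fderiv] at h1
  refine h1.symm.trans ?_
  exact Prod.ext rfl (one_smul ℝ (p.dtCoord α.1 α.1))

variable [LieGroup IG ∞ G]

theorem dtCoord_differential_infinitesimalGenerator (hφ : IsLieGroupAction I IG φ)
    (hinv : ∀ (g : G) (x : M), p.toFun (φ g x) = p.toFun x) (ξ : GroupLieAlgebra IG G)
    (α : CotangentBundle I M) :
    p.dtCoord α.1 α.1 (DiffForm.differential J (extChartAt J α) α
      (infinitesimalGenerator J IG (cotangentLift I φ) ξ α)).1 = 0 := by
  have hlift := hφ.isLieGroupAction_cotangentLift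
  rw [mfderiv_extChartAt_cotangent_fst (mem_chart_source H α.1),
    p.dtCoord_apply_coord (mem_chart_source H α.1)]
  have hproj : MDifferentiableAt J I (TotalSpace.proj : CotangentBundle I M → M) α :=
    (Bundle.contMDiff_proj (n := ∞) _ α).mdifferentiableAt (by simp)
  have hp : MDifferentiableAt I 𝓘(ℝ, ℝ) p.toFun α.1 :=
    (p.contMDiff α.1).mdifferentiableAt (by simp)
  have h1 := mfderiv_comp_apply α hp hproj (infinitesimalGenerator J IG (cotangentLift I φ) ξ α)
  have horb : MDifferentiableAt IG J (fun g : G => cotangentLift I φ g α) 1 :=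
    (hlift.contMDiff.comp (contMDiff_id.prodMk contMDiff_const) 1).mdifferentiableAt
      (n := ∞) (by simp)
  have h2 := mfderiv_comp_apply_of_eq (x := (1 : G)) (hp.comp α hproj) horb
    (hlift.one_act α) ξ
  have h3 : (p.toFun ∘ (TotalSpace.proj : CotangentBundle I M → M)) ∘
      (fun g : G => cotangentLift I φ g α) = fun _ => p.toFun α.1 :=
    funext fun g => hinv g α.1
  rw [h3, mfderiv_const] at h2
  exact h1.symm.trans h2.symm

theorem isCanonicalAction_cotangentLift [I.Boundaryless] (hφ : IsLieGroupAction I IG φ)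
    (hinv : ∀ (g : G) (x : M), p.toFun (φ g x) = p.toFun x) :
    IsCanonicalAction J IG p.psi (canonicalForm I M) (cotangentLift I φ) where
  action := hφ.isLieGroupAction_cotangentLift
  symplectic := hφ.pullback_cotangentLift_canonicalForm
  commute := p.cotangentLift_psi hφ hinv
  basic ξ α := by
    rw [canonicalForm_eq (mem_chart_source H α.1), DiffForm.pullFrom_apply, modelCanonical_apply]
    change (DiffForm.differential J (extChartAt J α) α
        (infinitesimalGenerator J IG (cotangentLift I φ) ξ α)).2
        (DiffForm.differential J (extChartAt J α) α (realGenerator J p.psi α)).1 -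
      (DiffForm.differential J (extChartAt J α) α (realGenerator J p.psi α)).2
        (DiffForm.differential J (extChartAt J α) α
          (infinitesimalGenerator J IG (cotangentLift I φ) ξ α)).1 = 0
    rw [p.differential_extChartAt_realGenerator,
      p.dtCoord_differential_infinitesimalGenerator hφ hinv, map_zero, sub_zero]

end FibrationOverReal

end Canonical

end

theorem mainTheorem12
    {E : Type*} [NormedAddCommGroup E] [NormedSpace ℝ E] [FiniteDimensional ℝ E]
    {H : Type*} [TopologicalSpace H] (I : ModelWithCorners ℝ E H) [I.Boundaryless]
    {M : Type*} [TopologicalSpace M] [ChartedSpace H M] [IsManifold I ∞ M]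
    {EG : Type*} [NormedAddCommGroup EG] [NormedSpace ℝ EG] [FiniteDimensional ℝ EG]
    {HG : Type*} [TopologicalSpace HG] (IG : ModelWithCorners ℝ EG HG) [IG.Boundaryless]
    {G : Type*} [Group G] [TopologicalSpace G] [ChartedSpace HG G] [LieGroup IG ∞ G]
    [ConnectedSpace G]
    (p : FibrationOverReal I M)
    (φ : G → M → M) (hφ : IsLieGroupAction I IG φ)
    (hinv : ∀ (g : G) (x : M), p.toFun (φ g x) = p.toFun x) :
    IsSymplecticPrincipalRBundle (I.prod 𝓘(ℝ, E →L[ℝ] ℝ))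
        (I.prod 𝓘(ℝ, FibrationOverReal.VerticalModel E →L[ℝ] ℝ))
        p.mu p.psi (canonicalForm I M) ∧
      IsCanonicalAction (I.prod 𝓘(ℝ, E →L[ℝ] ℝ)) IG p.psi (canonicalForm I M)
        (cotangentLift I φ) := by
  exact ⟨p.isSymplecticPrincipalRBundle_mu, p.isCanonicalAction_cotangentLift hφ hinv⟩
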